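/- Let $\Bbbk$ be a field, $n \ge 0$, and $B = \Bbbk[x_1,\dots,x_{n+1}]$ with the standard grading. For a homogeneous ideal $I$ of $B$ let $H_I(\mathfrak z)=\sum_t (\dim_\Bbbk I_t)\,\mathfrak z^t$ be its Hilbert series and $\beta^B_{i,j}(I)=\dim_\Bbbk \operatorname{Tor}^B_i(I,\Bbbk)_j$ ($i\in\mathbb N$, $j\in\mathbb Z$) its graded Betti numbers. A monomial ideal $J$ of $B$ is \emph{strongly stable} if for every monomial $m\in J$, every $q$ such that $x_q$ divides $m$, and every $p\le q$, also $x_p(m/x_q)\in J$. A monomial ideal $L$ of $B$ is a \emph{lex-segment ideal} if, whenever $u,v$ are monomials of the same degree, $v\in L$ and $u$ is larger than $v$ in the lexicographic order with $x_1>\dots>x_{n+1}$, then $u\in L$. Let $2\le e_1\le\cdots\le e_{n+1}\le\infty$ with $e_p\in\mathbb N\cup\{\infty\}$, and let $\mathfrak b=(x_1^{e_1},\dots,x_{n+1}^{e_{n+1}})$, where $x_p^{\infty}$ means $0$. Let $J$ be a strongly stable monomial ideal of $B$. Then: (1) For all $i,j$, the value of $\beta^B_{i,j}(J+\mathfrak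 b)$ does not depend on $\Bbbk$: if $K$ is any field and $J_K$ is the ideal of $K[x_1,\dots,x_{n+1}]$ generated by the same monomials as $J$, then $J_K+(x_1^{e_1},\dots,x_{n+1}^{e_{n+1}})$ has the same graded Betti numbers over $K[x_1,\dots,x_{n+1}]$ as $J+\mathfrak b$ has over $B$. (2) There is a lex-segment ideal $L$ of $B$ with $H_{L+\mathfrak b}=H_{J+\mathfrak b}$, and for every such $L$ and all $i,j$, $$\beta^B_{i,j}(J+\mathfrak b)\le\beta^B_{i,j}(L+\mathfrak b).$$ -/

import Mathlib

open MvPolynomial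

/-! ### Monomial ideals of `k[x_1, …, x_m]` -/

section MonomialIdeals

variable {k : Type*} [Field k] {m : ℕ}

/-- The ideal of `k[x_1, …, x_m]` generated by the monomials with exponents in `E`. -/
noncomputable def monomialIdeal (k : Type*) [Field k] {m : ℕ} (E : Set (Fin m →₀ ℕ)) :
    Ideal (MvPolynomial (Fin m) k) :=
  Ideal.span ((fun a => monomial a (1 : k)) '' E)

/-- The exponents of the monomials that lie in the ideal `I`. -/
def exponents (I : Ideal (MvPolynomial (Fin m) k)) : Set (Fin m →₀ ℕ) :=
  {a | monomial a (1 : k) ∈ I}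

/-- `I` is a monomial ideal: it is generated by the monomials it contains. -/
def IsMonomialIdeal (I : Ideal (MvPolynomial (Fin m) k)) : Prop :=
  I = monomialIdeal k (exponents I)

/-- `I` is a strongly stable monomial ideal: if a monomial `u ∈ I` is divisible by `x_q`, then
`x_p (u / x_q) ∈ I` for all `p ≤ q`. -/
def IsStronglyStable (I : Ideal (MvPolynomial (Fin m) k)) : Prop :=
  IsMonomialIdeal I ∧
    ∀ a ∈ exponents I, ∀ q : Fin m, a q ≠ 0 → ∀ p ≤ q,
      a - Finsupp.single q 1 + Finsupp.single p 1 ∈ exponents I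

/-- `I` is a lex-segment ideal: a monomial ideal which, with a monomial `v`, contains every monomial
`u` of the same degree that is larger than `v` in the lexicographic order with
`x_1 > x_2 > … > x_m`. -/
def IsLexSegment (I : Ideal (MvPolynomial (Fin m) k)) : Prop :=
  IsMonomialIdeal I ∧
    ∀ u v : Fin m →₀ ℕ, u.degree = v.degree → toLex v < toLex u →
      v ∈ exponents I → u ∈ exponents I

/-- The ideal `(x_1^{e_1}, …, x_m^{e_m})`, where `x_p^∞` means `0`. -/
noncomputable def powersIdeal (k : Type*) [Field k] {m : ℕ} (e : Fin m → ℕ∞) :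
    Ideal (MvPolynomial (Fin m) k) :=
  Ideal.span {f | ∃ (p : Fin m) (d : ℕ), e p = d ∧ f = X p ^ d}

end MonomialIdeals

/-! ### Hilbert series -/

section Hilbert

variable {k : Type*} [Field k] {m : ℕ}

/-- The forms of degree `d` in `k[x_1, …, x_m]`, for `d ∈ ℤ`. -/
noncomputable def forms (k : Type*) [Field k] (m : ℕ) : ℤ → Submodule k (MvPolynomial (Fin m) k)
  | .ofNat d => homogeneousSubmodule (Fin m) k d
  | .negSucc _ => ⊥

/-- The degree `d` component of the (homogeneous) ideal `I`. -/
noncomputable def idealPart (I : Ideal (MvPolynomial (Fin m) k)) (d : ℤ) :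
    Submodule k (MvPolynomial (Fin m) k) :=
  I.restrictScalars k ⊓ forms k m d

/-- The Hilbert series of the (homogeneous) ideal `I`, as a graded module; its components of
negative degree vanish. -/
noncomputable def hilbertSeries (I : Ideal (MvPolynomial (Fin m) k)) : PowerSeries ℤ :=
  PowerSeries.mk fun d => (Module.finrank k (idealPart I d) : ℤ)

end Hilbert

/-! ### Graded Betti numbers

`Tor_i(I, k)_j` over `B = k[x_1, …, x_m]` is the homology of `I ⊗ K` in homological degree `i` and
internal degree `j`, where `K` is the Koszul complex on `x_1, …, x_m`. It is the graded free
resolution of `k` with `K_i` free on the symbols `e_σ` (`σ` a subset of the variables with `i`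
elements, `e_σ` of degree `i`) and
`∂ e_σ = ∑_{l ∈ σ} (-1)^{#{a ∈ σ : a < l}} x_l e_{σ \ {l}}`. An element `∑ f_σ e_σ` of `⨁ K_i` is
written as the function `f`, and `I ⊗ K_i` as the functions with values in `I`. -/

section Betti

variable {k : Type*} [Field k] {m : ℕ}

/-- The differential of the Koszul complex: the coefficient of `e_τ` in `∂ (∑ f_σ e_σ)`. -/
noncomputable def koszulD (k : Type*) [Field k] (m : ℕ) :
    (Finset (Fin m) → MvPolynomial (Fin m) k) →ₗ[MvPolynomial (Fin m) k]
      (Finset (Fin m) → MvPolynomial (Fin m) k) where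
  toFun f τ := ∑ l ∈ τᶜ, (-1) ^ (τ.filter (· < l)).card * (X l * f (insert l τ))
  map_add' f g := by
    funext τ
    simp only [Pi.add_apply, mul_add, Finset.sum_add_distrib]
  map_smul' c f := by
    funext τ
    simp only [Pi.smul_apply, smul_eq_mul, Finset.mul_sum, RingHom.id_apply]
    exact Finset.sum_congr rfl fun l _ => by ring

/-- The component `(I ⊗ K_i)_j` of homological degree `i` and internal degree `j`. -/
noncomputable def koszulChains (I : Ideal (MvPolynomial (Fin m) k)) (i : ℕ) (j : ℤ) :
    Submodule k (Finset (Fin m) → MvPolynomial (Fin m) k) where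
  carrier := {f | ∀ σ, f σ ∈ idealPart I (j - i) ∧ (σ.card ≠ i → f σ = 0)}
  add_mem' {f g} hf hg σ :=
    ⟨add_mem (hf σ).1 (hg σ).1, fun h => by simp [(hf σ).2 h, (hg σ).2 h]⟩
  zero_mem' σ := ⟨zero_mem _, fun _ => rfl⟩
  smul_mem' c f hf σ := ⟨Submodule.smul_mem _ c (hf σ).1, fun h => by simp [(hf σ).2 h]⟩

/-- The cycles in `(I ⊗ K_i)_j`. -/
noncomputable def koszulCycles (I : Ideal (MvPolynomial (Fin m) k)) (i : ℕ) (j : ℤ) :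
    Submodule k (Finset (Fin m) → MvPolynomial (Fin m) k) :=
  koszulChains I i j ⊓ LinearMap.ker ((koszulD k m).restrictScalars k)

/-- The boundaries in `(I ⊗ K_i)_j`. -/
noncomputable def koszulBoundaries (I : Ideal (MvPolynomial (Fin m) k)) (i : ℕ) (j : ℤ) :
    Submodule k (Finset (Fin m) → MvPolynomial (Fin m) k) :=
  (koszulChains I (i + 1) j).map ((koszulD k m).restrictScalars k)

/-- `K` is a complex. -/
theorem koszulD_koszulD (f : Finset (Fin m) → MvPolynomial (Fin m) k) :
    koszulD k m (koszulD k m f) = 0 := by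
  funext τ
  simp only [koszulD, LinearMap.coe_mk, AddHom.coe_mk, Finset.mul_sum, Pi.zero_apply]
  rw [Finset.sum_sigma']
  refine Finset.sum_involution (fun x _ => ⟨x.2, x.1⟩) ?_ ?_ ?_ ?_
  · rintro ⟨a, b⟩ h
    simp only [Finset.mem_sigma, Finset.mem_compl, Finset.mem_insert, not_or] at h
    obtain ⟨ha, hba, hb⟩ := h
    simp only [Finset.insert_comm b a, Finset.filter_insert]
    rcases lt_or_gt_of_ne hba with h | h
    · rw [if_neg (not_lt.2 h.le), if_pos h, Finset.card_insert_of_notMem (by simp [hb])]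
      ring
    · rw [if_pos h, if_neg (not_lt.2 h.le), Finset.card_insert_of_notMem (by simp [ha])]
      ring
  · rintro ⟨a, b⟩ h _ hh
    simp only [Finset.mem_sigma, Finset.mem_compl, Finset.mem_insert, not_or] at h
    simp only [Sigma.mk.injEq] at hh
    exact h.2.1 hh.1
  · rintro ⟨a, b⟩ h
    simp only [Finset.mem_sigma, Finset.mem_compl, Finset.mem_insert, not_or] at h ⊢
    exact ⟨h.2.2, fun h' => h.2.1 h'.symm, h.1⟩
  · rintro ⟨a, b⟩ h
    rfl

theorem coeff_koszulD (f : Finset (Fin m) → MvPolynomial (Fin m) k) (τ : Finset (Fin m))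
    (c : Fin m →₀ ℕ) :
    coeff c (koszulD k m f τ) = ∑ l ∈ τᶜ, (-1) ^ (τ.filter (· < l)).card *
      (if c l ≠ 0 then coeff (c - Finsupp.single l 1) (f (insert l τ)) else 0) := by
  simp only [koszulD, LinearMap.coe_mk, AddHom.coe_mk, coeff_sum]
  refine Finset.sum_congr rfl fun l _ => ?_
  have : ((-1 : MvPolynomial (Fin m) k) ^ (τ.filter (· < l)).card)
      = C ((-1) ^ (τ.filter (· < l)).card) := by simp
  rw [this, coeff_C_mul, coeff_X_mul']
  simp

/-- `K` is a resolution of `k`: a cycle in `⨁ K_i` whose component in `K_0 = B` has constant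
term zero is a boundary. -/
theorem koszulD_exact (f : Finset (Fin m) → MvPolynomial (Fin m) k) (hf : koszulD k m f = 0)
    (h0 : coeff 0 (f ∅) = 0) : ∃ g, koszulD k m g = f := by
  classical
  have hT : ∀ (l : Fin m) (p : MvPolynomial (Fin m) k), ∃ q : MvPolynomial (Fin m) k,
      ∀ c, coeff c q = if ∀ b < l, c b = 0 then coeff (c + Finsupp.single l 1) p else 0 := by
    intro l p
    refine ⟨∑ a ∈ (p.divMonomial (Finsupp.single l 1)).support with ∀ b < l, a b = 0,
      monomial a (coeff a (p.divMonomial (Finsupp.single l 1))), fun c => ?_⟩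
    simp only [coeff_sum, coeff_monomial, Finset.sum_ite_eq', Finset.mem_filter, mem_support_iff,
      coeff_divMonomial, add_comm (Finsupp.single l 1)]
    by_cases h : ∀ b < l, c b = 0 <;>
      by_cases h' : coeff (c + Finsupp.single l 1) p = 0 <;> simp [h, h']
  choose T hT using hT
  refine ⟨fun σ => if h : σ.Nonempty then T (σ.min' h) (f (σ.erase (σ.min' h))) else 0, ?_⟩
  -- the value of the homotopy on a set with known least element
  set g : Finset (Fin m) → MvPolynomial (Fin m) k :=
    fun σ => if h : σ.Nonempty then T (σ.min' h) (f (σ.erase (σ.min' h))) else 0 with hg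
  have hgv : ∀ (σ : Finset (Fin m)) (l : Fin m), l ∈ σ → (∀ b ∈ σ, l ≤ b) →
      g σ = T l (f (σ.erase l)) := by
    intro σ l hl hmin
    have hne : σ.Nonempty := ⟨l, hl⟩
    have : σ.min' hne = l := le_antisymm (Finset.min'_le _ _ hl) (Finset.le_min' _ _ _ hmin)
    simp only [hg, dif_pos hne, this]
  funext τ
  ext c
  rw [coeff_koszulD]
  rcases (c.support ∪ τ).eq_empty_or_nonempty with hem | hne
  · obtain ⟨hc, ht⟩ := Finset.union_eq_empty.1 hem
    have hc : c = 0 := Finsupp.support_eq_empty.1 hc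
    subst hc ht
    simp [h0]
  obtain ⟨l, hl, hmin⟩ : ∃ l ∈ c.support ∪ τ, ∀ b ∈ c.support ∪ τ, l ≤ b :=
    ⟨_, Finset.min'_mem _ hne, fun b hb => Finset.min'_le _ _ hb⟩
  have hminc : ∀ b, c b ≠ 0 → l ≤ b := fun b hb => hmin b (by simp [hb])
  have hcz : ∀ b < l, c b = 0 := fun b hb => by
    by_contra h
    exact absurd (hminc b h) (not_le.2 hb)
  have hmint : ∀ b ∈ τ, l ≤ b := fun b hb => hmin b (by simp [hb])
  by_cases hlt : l ∈ τ
  · -- the least index lies in `τ`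
    have key := coeff_koszulD f (τ.erase l) (c + Finsupp.single l 1)
    rw [hf] at key
    have hcomp : (τ.erase l)ᶜ = insert l τᶜ := by simp [Finset.compl_erase]
    rw [hcomp, Finset.sum_insert (by simp [hlt])] at key
    have hfe : (τ.erase l).filter (· < l) = ∅ := by
      refine Finset.filter_eq_empty_iff.2 fun b hb => ?_
      exact not_lt.2 (hmint b (Finset.mem_of_mem_erase hb))
    rw [hfe] at key
    simp only [Pi.zero_apply, coeff_zero, Finset.card_empty, pow_zero, one_mul,
      Finsupp.add_apply, Finsupp.single_eq_same, Finset.insert_erase hlt,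
      add_tsub_cancel_right] at key
    rw [if_pos (by omega)] at key
    rw [eq_neg_of_add_eq_zero_left key.symm, ← Finset.sum_neg_distrib]
    refine Finset.sum_congr rfl fun p hp => ?_
    have hp : p ∉ τ := by simpa using hp
    have hpl : p ≠ l := fun h => hp (h ▸ hlt)
    have hs : (Finsupp.single l 1 : Fin m →₀ ℕ) p = 0 := by
      simp [hpl.symm]
    simp only [hs, add_zero]
    by_cases hcp : c p ≠ 0
    · have hlp : l < p := lt_of_le_of_ne (hminc p hcp) hpl.symm
      rw [if_pos hcp, if_pos hcp, hgv (insert p τ) l (by simp [hlt])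
        (by simpa using ⟨hlp.le, hmint⟩), hT, if_pos, Finset.erase_insert_of_ne hpl]
      · have h1 : τ.filter (· < p) = insert l ((τ.erase l).filter (· < p)) := by
          ext b
          simp only [Finset.mem_filter, Finset.mem_insert, Finset.mem_erase]
          by_cases hb : b = l
          · subst hb; simp [hlt, hlp]
          · simp [hb]
        have h2 : c - Finsupp.single p 1 + Finsupp.single l 1
            = c + Finsupp.single l 1 - Finsupp.single p 1 := by
          ext b
          simp only [Finsupp.add_apply, Finsupp.tsub_apply, Finsupp.single_apply]
          split_ifs <;> grind
        rw [h1, Finset.card_insert_of_notMem (by simp), h2]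
        ring
      · intro b hb
        simp [hcz b hb]
    · simp [hcp]
  · -- the least index does not lie in `τ`
    have hcl : c l ≠ 0 := by simpa [hlt] using hl
    rw [Finset.sum_eq_single_of_mem l (by simp [hlt])]
    · have hfe : τ.filter (· < l) = ∅ :=
        Finset.filter_eq_empty_iff.2 fun b hb => not_lt.2 (hmint b hb)
      rw [if_pos hcl, hfe, hgv (insert l τ) l (by simp) (by simpa using hmint),
        Finset.erase_insert hlt, hT, if_pos, tsub_add_cancel_of_le]
      · simp
      · rw [Finsupp.single_le_iff]; omega
      · intro b hb
        simp [hcz b hb]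
    · intro p hp hpl
      have hp : p ∉ τ := by simpa using hp
      by_cases hcp : c p ≠ 0
      · have hlp : l < p := lt_of_le_of_ne (hminc p hcp) hpl.symm
        have hne' : (insert p τ).Nonempty := Finset.insert_nonempty _ _
        rw [if_pos hcp, hgv _ _ (Finset.min'_mem _ hne') fun b hb => Finset.min'_le _ _ hb, hT,
          if_neg, mul_zero]
        intro h
        have hlm : l < (insert p τ).min' hne' := by
          rw [Finset.lt_min'_iff]
          intro b hb
          rcases Finset.mem_insert.1 hb with rfl | hb
          · exact hlp
          · exact lt_of_le_of_ne (hmint b hb) fun h => hlt (h ▸ hb)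
        have := h l hlm
        simp [hpl] at this
        exact hcl this
      · simp [hcp]

theorem X_mul_mem_forms {d : ℤ} {p : MvPolynomial (Fin m) k} (l : Fin m) (hp : p ∈ forms k m d) :
    X l * p ∈ forms k m (d + 1) := by
  cases d with
  | ofNat d =>
    have h : (Int.ofNat d + 1 : ℤ) = Int.ofNat (1 + d) := by simp [add_comm]
    rw [h]
    exact (isHomogeneous_X k l).mul hp
  | negSucc d =>
    have h : p = 0 := hp
    simp [h]

/-- The boundaries are cycles. -/
theorem koszulBoundaries_le (I : Ideal (MvPolynomial (Fin m) k)) (i : ℕ) (j : ℤ) :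
    koszulBoundaries I i j ≤ koszulCycles I i j := by
  rintro _ ⟨f, hf, rfl⟩
  refine ⟨fun τ => ⟨?_, fun hτ => ?_⟩, koszulD_koszulD f⟩
  · refine sum_mem fun l _ => ?_
    obtain ⟨h1, h2⟩ := (hf (insert l τ)).1
    have h3 := X_mul_mem_forms l h2
    have h4 : j - ((i + 1 : ℕ) : ℤ) + 1 = j - i := by push_cast; ring
    rw [h4] at h3
    have h5 : X l * f (insert l τ) ∈ idealPart I (j - i) := ⟨I.mul_mem_left _ h1, h3⟩
    rcases neg_one_pow_eq_or (MvPolynomial (Fin m) k) (τ.filter (· < l)).card with h | h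
    · rw [h, one_mul]; exact h5
    · rw [h, neg_one_mul]; exact neg_mem h5
  · refine Finset.sum_eq_zero fun l hl => ?_
    have h : (insert l τ).card ≠ i + 1 := by
      rw [Finset.card_insert_of_notMem (by simpa using hl)]; omega
    rw [(hf (insert l τ)).2 h]; simp

/-- The graded Betti number `β_{i,j}(I) = dim_k Tor_i(I, k)_j` over `k[x_1, …, x_m]` of the
homogeneous ideal `I`, regarded as a graded module. -/
noncomputable def gradedBetti (I : Ideal (MvPolynomial (Fin m) k)) (i : ℕ) (j : ℤ) : ℕ :=
  Module.finrank k
    (koszulCycles I i j ⧸ (koszulBoundaries I i j).submoduleOf (koszulCycles I i j))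

end Betti

/-!
Write `𝔟` for the ideal of powers and `I = J + 𝔟`. The graded Betti numbers of `I` are determined
by its Hilbert function and the dimensions of the spaces of Koszul cycles in `I ⊗ K`
(`HasExponents.gradedBetti_add`), so everything rests on computing the latter.

*Cycles.* In a multidegree `a ≠ 0`, let `v` be the pivot of `a`: the last variable in `x^a` whose
exponent differs from `e_v` (or the last variable at all, if there is none). If `x^c e_σ` has
multidegree `a`, `x^c ∈ I` and `v ∉ σ`, then `x_p x^c / x_v ∈ I` for every `p ∈ σ`: for `p < v`
because `J` is strongly stable, and otherwise because the exponent of `x_p` becomes `e_p`, unless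
`x_p x^c / x_v` lies in `𝔟` together with `x^c` anyway (`exchange_pivot_mem`). Hence the boundary
of `x^{c - v} e_{σ ∪ v}` lies in `I ⊗ K`, and the cycles of multidegree `a` have as coordinates
their coefficients at the `σ` not containing `v` (`HasExponents.finrank_koszulCycles`). The
dimension is thus a number of pairs `(σ, c)` which does not involve the field.

*Weights.* Apart from a contribution of `𝔟` alone, this number is a sum over the monomials `x^u`
of `J` outside `𝔟`, of the given positive degree, of a weight depending on `u` only. With `z` the
last of `n + 1` variables, the weight polynomial `g(u) = ∑ weight(u)_i t^i` satisfies `g(y z^s) =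
g(y)` for `s = 0`, `(1 + t)^n` for `0 < s < e_z - 1`, and `(1 + t)^n + t g(y)` for `s = e_z - 1`
(`card_filter_isGood`). In particular `g(y) ≤ (1 + t)^n`.

*Comparison.* It remains to show that in each degree the lexicographic segment has the largest
total weight among the strongly stable sets of its size (`sum_weight_le`). For a set `V` let `V_s`
be the set of `y` with `y z^s ∈ V`. If `|V_s| > |L_s|` for some `s`, then `|V_r| ≥ |L_r|` for all
`r ≤ s` (`card_slice_le_of_lt`), so `V_0` is at least as large as `L_0` and `V_{e_z - 1}` at most
as large as `L_{e_z - 1}`. By induction on the number of variables the slices of `V` may be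
replaced by lexicographic segments, and then the bound `g ≤ (1 + t)^n` shows that passing from `V`
to `L` loses nothing. The comparison of slices uses the Clements–Lindström inequality for Borel
sets (`shadowBound`), proved by the same induction, which also yields the existence of the
lexicographic ideal (`exists_isLexSegment`).
-/

/-! ### Monomials in a box and lexicographic segments -/

section Box

variable {n : ℕ}

/-- The exponents of degree `d` of the monomials outside `(x_1^{e_1}, …, x_n^{e_n})`. -/
def box (e : Fin n → ℕ∞) (d : ℕ) : Finset (Fin n → ℕ) :=
  (Finset.piAntidiag Finset.univ d).filter fun u => ∀ p, (u p : ℕ∞) < e p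

theorem mem_box {e : Fin n → ℕ∞} {d : ℕ} {u : Fin n → ℕ} :
    u ∈ box e d ↔ ∑ p, u p = d ∧ ∀ p, (u p : ℕ∞) < e p := by
  simp [box]

/-- `V` is strongly stable inside the box: exchanging a variable for an earlier one does not leave
`V`, unless the result leaves the box. -/
def IsBorel (e : Fin n → ℕ∞) (V : Finset (Fin n → ℕ)) : Prop :=
  ∀ u ∈ V, ∀ p q, p < q → u q ≠ 0 → ((u p + 1 : ℕ) : ℕ∞) < e p →
    u - Pi.single q 1 + Pi.single p 1 ∈ V

/-- `L` is an initial segment of `box e d` in the lexicographic order, starting with the largest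
element. -/
def IsLexSet (e : Fin n → ℕ∞) (d : ℕ) (L : Finset (Fin n → ℕ)) : Prop :=
  L ⊆ box e d ∧ ∀ v ∈ L, ∀ u ∈ box e d, toLex v < toLex u → u ∈ L

/-- The elements of the box that are a variable times an element of `V`. -/
def shadow (e : Fin n → ℕ∞) (d : ℕ) (V : Finset (Fin n → ℕ)) : Finset (Fin n → ℕ) :=
  (box e (d + 1)).filter fun w => ∃ u ∈ V, ∃ p, w = u + Pi.single p 1

theorem mem_shadow {e : Fin n → ℕ∞} {d : ℕ} {V : Finset (Fin n → ℕ)} {w : Fin n → ℕ} :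
    w ∈ shadow e d V ↔ w ∈ box e (d + 1) ∧ ∃ u ∈ V, ∃ p, w = u + Pi.single p 1 := by
  simp [shadow]

theorem sum_add_single (u : Fin n → ℕ) (p : Fin n) :
    ∑ i, (u + Pi.single p 1 : Fin n → ℕ) i = ∑ i, u i + 1 := by
  simp [Finset.sum_add_distrib]

theorem sub_add_single {u : Fin n → ℕ} {q : Fin n} (h : u q ≠ 0) :
    u - Pi.single q 1 + Pi.single q 1 = u := by
  funext i
  rcases eq_or_ne i q with rfl | hi
  · simp; omega
  · simp [hi]

theorem sum_sub_single {u : Fin n → ℕ} {q : Fin n} (h : u q ≠ 0) :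
    ∑ i, (u - Pi.single q 1 : Fin n → ℕ) i + 1 = ∑ i, u i := by
  rw [← sum_add_single, sub_add_single h]

theorem mem_box_of_le {e : Fin n → ℕ∞} {d d' : ℕ} {u v : Fin n → ℕ} (hv : v ∈ box e d)
    (h : u ≤ v) (hd : ∑ i, u i = d') : u ∈ box e d' :=
  mem_box.2 ⟨hd, fun p => lt_of_le_of_lt (by exact_mod_cast h p) ((mem_box.1 hv).2 p)⟩

/-- `y` arises from `y'` by multiplication with variables none of which precedes a variable
of `y'`; that is, `y'` is a prefix of `y` when monomials are written as nondecreasing words. -/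
def IsPrefix (y' y : Fin n → ℕ) : Prop :=
  y' ≤ y ∧ ∀ i, y' i < y i → ∀ j, i < j → y' j = 0

theorem IsPrefix.refl (y : Fin n → ℕ) : IsPrefix y y :=
  ⟨le_rfl, fun _ h => absurd h (lt_irrefl _)⟩

theorem exists_last_ne_zero {w : Fin n → ℕ} (h : ∑ i, w i ≠ 0) :
    ∃ q, w q ≠ 0 ∧ ∀ j, q < j → w j = 0 := by
  have hne : (Finset.univ.filter fun i => w i ≠ 0).Nonempty := by
    obtain ⟨i, -, hi⟩ := Finset.exists_ne_zero_of_sum_ne_zero h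
    exact ⟨i, by simpa using hi⟩
  obtain ⟨q, hq, hmax⟩ := Finset.exists_max_image _ id hne
  refine ⟨q, by simpa using hq, fun j hj => ?_⟩
  by_contra hj'
  exact absurd (hmax j (by simpa using hj')) (not_le.2 hj)

/-- A prefix stays a prefix when its last letter is deleted. -/
theorem IsPrefix.sub_single {w y : Fin n → ℕ} (h : IsPrefix w y) {q : Fin n}
    (hq : ∀ j, q < j → w j = 0) : IsPrefix (w - Pi.single q 1) y := by
  refine ⟨fun i => le_trans (by simp) (h.1 i), fun i hi j hj => ?_⟩
  rcases lt_or_ge (w i) (y i) with h' | h'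
  · simp [h.2 i h' j hj]
  · rcases eq_or_ne i q with rfl | hiq
    · simp [hq j hj]
    · simp [hiq] at hi
      omega

/-- Lexicographic comparison of words of the same length is decided by any extension of the
smaller one. -/
theorem IsPrefix.toLex_lt {y' y w : Fin n → ℕ} (h : IsPrefix y' y)
    (hd : ∑ i, y' i = ∑ i, w i) (hlt : toLex y' < toLex w) : toLex y < toLex w := by
  obtain ⟨i, hi, hi'⟩ := hlt
  change ∀ j, j < i → y' j = w j at hi
  change y' i < w i at hi'
  obtain ⟨k, hk, hk'⟩ : ∃ k, i < k ∧ y' k ≠ 0 := by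
    by_contra! hcon
    refine absurd hd (ne_of_lt (Finset.sum_lt_sum (fun j _ => ?_) ⟨i, Finset.mem_univ _, hi'⟩))
    rcases lt_trichotomy j i with hj | rfl | hj
    · exact (hi j hj).le
    · exact hi'.le
    · simp [hcon j hj]
  have heq : ∀ j ≤ i, y j = y' j := fun j hj => by
    by_contra hne
    exact hk' (h.2 j (lt_of_le_of_ne (h.1 j) (Ne.symm hne)) k (lt_of_le_of_lt hj hk))
  exact ⟨i, fun j hj => (heq j (le_of_lt hj)).trans (hi j hj), by
    change y i < w i
    rw [heq i le_rfl]; exact hi'⟩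

theorem IsLexSet.mem_of_not_lt {e : Fin n → ℕ∞} {d : ℕ} {L : Finset (Fin n → ℕ)}
    (hL : IsLexSet e d L) {u v : Fin n → ℕ} (hv : v ∈ L) (hu : u ∈ box e d)
    (h : ¬ toLex u < toLex v) : u ∈ L := by
  rcases (not_lt.1 h).lt_or_eq with h | h
  · exact hL.2 v hv u hu h
  · rwa [← toLex.injective h]

theorem toLex_le_add_single (u : Fin n → ℕ) (p : Fin n) :
    toLex u ≤ toLex (u + Pi.single p 1) :=
  Pi.toLex_monotone fun i => by simp

theorem toLex_lt_exchange {u : Fin n → ℕ} {p q : Fin n} (h : p < q) :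
    toLex u < toLex (u - Pi.single q 1 + Pi.single p 1) := by
  refine ⟨p, fun j hj => ?_, ?_⟩
  · change u j = _
    simp [hj.ne, (hj.trans h).ne]
  · change u p < (u - Pi.single q 1 + Pi.single p 1 : Fin n → ℕ) p
    simp [h.ne]

theorem exchange_mem_box {e : Fin n → ℕ∞} {d : ℕ} {u : Fin n → ℕ} (hu : u ∈ box e d)
    {p q : Fin n} (hpq : p < q) (hq : u q ≠ 0) (hp : ((u p + 1 : ℕ) : ℕ∞) < e p) :
    u - Pi.single q 1 + Pi.single p 1 ∈ box e d := by
  have hb := mem_box.1 hu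
  refine mem_box.2 ⟨?_, fun i => ?_⟩
  · rw [sum_add_single, sum_sub_single hq, hb.1]
  · rcases eq_or_ne i p with rfl | hi
    · simpa [hpq.ne] using hp
    · refine lt_of_le_of_lt ?_ (hb.2 i)
      simp [hi]

theorem IsLexSet.isBorel {e : Fin n → ℕ∞} {d : ℕ} {L : Finset (Fin n → ℕ)}
    (hL : IsLexSet e d L) : IsBorel e L := fun u hu _ _ hpq hq hp =>
  hL.2 u hu _ (exchange_mem_box (hL.1 hu) hpq hq hp) (toLex_lt_exchange hpq)

/-- The shadow of a lexicographic segment is again one. -/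
theorem isLexSet_shadow {e : Fin n → ℕ∞} {d : ℕ} {L : Finset (Fin n → ℕ)}
    (hL : IsLexSet e d L) : IsLexSet e (d + 1) (shadow e d L) := by
  refine ⟨Finset.filter_subset _ _, fun v hv w hw hlt => ?_⟩
  obtain ⟨-, u, hu, p, rfl⟩ := mem_shadow.1 hv
  have hws := (mem_box.1 hw).1
  obtain ⟨q, hq, hlast⟩ := exists_last_ne_zero (w := w) (by omega)
  have hs := sum_sub_single hq
  refine mem_shadow.2 ⟨hw, w - Pi.single q 1, ?_, q, (sub_add_single hq).symm⟩
  refine hL.mem_of_not_lt hu (mem_box_of_le hw (fun i => by simp) (by omega)) fun hcon => ?_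
  have := ((IsPrefix.refl w).sub_single hlast).toLex_lt
    (by have := (mem_box.1 (hL.1 hu)).1; omega) hcon
  exact absurd (hlt.trans this) (not_lt.2 (toLex_le_add_single u p))

theorem IsLexSet.subset_of_card_le {e : Fin n → ℕ∞} {d : ℕ} {L M : Finset (Fin n → ℕ)}
    (hL : IsLexSet e d L) (hM : IsLexSet e d M) (h : L.card ≤ M.card) : L ⊆ M := by
  by_contra hcon
  obtain ⟨u, hu, huM⟩ := Finset.not_subset.1 hcon
  have hML : M ⊂ L := by
    refine (Finset.ssubset_iff_of_subset fun v hv => ?_).2 ⟨u, hu, huM⟩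
    exact hL.mem_of_not_lt hu (hM.1 hv) fun hlt => huM (hM.2 v hv u (hL.1 hu) hlt)
  exact absurd (Finset.card_lt_card hML) (not_lt.2 h)

theorem IsLexSet.exists_insert {e : Fin n → ℕ∞} {d : ℕ} {L : Finset (Fin n → ℕ)}
    (hL : IsLexSet e d L) (h : L.card < (box e d).card) :
    ∃ w ∉ L, IsLexSet e d (insert w L) := by
  have hne : (box e d \ L).Nonempty := by
    rw [Finset.sdiff_nonempty]
    exact fun hsub => absurd (Finset.card_le_card hsub) (not_le.2 h)
  obtain ⟨w, hw, hmax⟩ := Finset.exists_max_image _ (fun u => toLex u) hne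
  rw [Finset.mem_sdiff] at hw
  refine ⟨w, hw.2, Finset.insert_subset hw.1 hL.1, fun v hv u hu hlt => ?_⟩
  by_contra hcon
  rw [Finset.mem_insert, not_or] at hcon
  rcases Finset.mem_insert.1 hv with rfl | hv
  · exact absurd (hmax u (Finset.mem_sdiff.2 ⟨hu, hcon.2⟩)) (not_le.2 hlt)
  · exact hcon.2 (hL.2 v hv u hu hlt)

theorem exists_isLexSet_card {e : Fin n → ℕ∞} {d c : ℕ} (h : c ≤ (box e d).card) :
    ∃ L, IsLexSet e d L ∧ L.card = c := by
  induction c with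
  | zero => exact ⟨∅, ⟨by simp, by simp⟩, rfl⟩
  | succ c ih =>
    obtain ⟨L, hL, hc⟩ := ih (by omega)
    obtain ⟨w, hw, hL'⟩ := hL.exists_insert (by omega)
    exact ⟨_, hL', by rw [Finset.card_insert_of_notMem hw, hc]⟩

end Box

/-! ### Slices with respect to the last variable -/

section Slices

variable {n : ℕ}

/-- The monomials `y` in all but the last variable `z` with `y z^t ∈ V`. -/
def slice (V : Finset (Fin (n + 1) → ℕ)) (t : ℕ) : Finset (Fin n → ℕ) :=
  (V.filter fun u => u (Fin.last n) = t).image Fin.init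

theorem mem_slice {V : Finset (Fin (n + 1) → ℕ)} {t : ℕ} {y : Fin n → ℕ} :
    y ∈ slice V t ↔ (Fin.snoc y t : Fin (n + 1) → ℕ) ∈ V := by
  simp only [slice, Finset.mem_image, Finset.mem_filter]
  constructor
  · rintro ⟨u, ⟨hu, rfl⟩, rfl⟩
    rwa [Fin.snoc_init_self]
  · exact fun h => ⟨_, ⟨h, Fin.snoc_last _ _⟩, Fin.init_snoc _ _⟩

theorem init_injOn (V : Finset (Fin (n + 1) → ℕ)) (t : ℕ) :
    Set.InjOn (Fin.init : (Fin (n + 1) → ℕ) → Fin n → ℕ)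
      (V.filter fun u => u (Fin.last n) = t) := by
  intro u hu v hv h
  have hu := (Finset.mem_filter.1 hu).2
  have hv := (Finset.mem_filter.1 hv).2
  rw [← Fin.snoc_init_self u, ← Fin.snoc_init_self v, hu, hv]
  exact congrArg (fun y => (Fin.snoc y t : Fin (n + 1) → ℕ)) h

theorem sum_snoc (y : Fin n → ℕ) (t : ℕ) :
    ∑ i, (Fin.snoc y t : Fin (n + 1) → ℕ) i = ∑ i, y i + t := by
  simp [Fin.sum_univ_castSucc]

theorem snoc_mem_box {e : Fin (n + 1) → ℕ∞} {d t : ℕ} {y : Fin n → ℕ} :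
    (Fin.snoc y t : Fin (n + 1) → ℕ) ∈ box e d ↔
      t ≤ d ∧ (t : ℕ∞) < e (Fin.last n) ∧ y ∈ box (Fin.init e) (d - t) := by
  simp only [mem_box, sum_snoc, Fin.forall_fin_succ', Fin.snoc_castSucc, Fin.snoc_last, Fin.init]
  constructor
  · rintro ⟨h1, h2, h3⟩
    exact ⟨by omega, h3, by omega, h2⟩
  · rintro ⟨h1, h2, h3, h4⟩
    exact ⟨by omega, h4, h2⟩

theorem snoc_add_single_castSucc (y : Fin n → ℕ) (t : ℕ) (p : Fin n) :
    (Fin.snoc y t : Fin (n + 1) → ℕ) + Pi.single p.castSucc 1 =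
      Fin.snoc (y + Pi.single p 1) t := by
  funext i
  refine Fin.lastCases ?_ (fun i => ?_) i
  · simp [Fin.ext_iff, p.2.ne']
  · simp [Pi.single_apply]

theorem snoc_add_single_last (y : Fin n → ℕ) (t : ℕ) :
    (Fin.snoc y t : Fin (n + 1) → ℕ) + Pi.single (Fin.last n) 1 = Fin.snoc y (t + 1) := by
  funext i
  refine Fin.lastCases ?_ (fun i => ?_) i
  · simp
  · simp [Fin.ext_iff, i.2.ne]

theorem snoc_sub_single_last (y : Fin n → ℕ) (t : ℕ) :
    (Fin.snoc y (t + 1) : Fin (n + 1) → ℕ) - Pi.single (Fin.last n) 1 = Fin.snoc y t := by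
  rw [← snoc_add_single_last, add_tsub_cancel_right]

theorem snoc_sub_single_castSucc (y : Fin n → ℕ) (t : ℕ) (p : Fin n) :
    (Fin.snoc y t : Fin (n + 1) → ℕ) - Pi.single p.castSucc 1 =
      Fin.snoc (y - Pi.single p 1) t := by
  funext i
  refine Fin.lastCases ?_ (fun i => ?_) i
  · simp [Fin.ext_iff, p.2.ne']
  · simp [Pi.single_apply]

theorem toLex_snoc_lt {y w : Fin n → ℕ} {t s : ℕ} (h : toLex y < toLex w) :
    toLex (Fin.snoc y t : Fin (n + 1) → ℕ) < toLex (Fin.snoc w s : Fin (n + 1) → ℕ) := by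
  obtain ⟨i, hi, hi'⟩ := h
  refine ⟨i.castSucc, fun j hj => ?_, ?_⟩
  · induction j using Fin.lastCases with
    | last => exact absurd (Fin.le_last i.castSucc) (not_le.2 hj)
    | cast j =>
      change (Fin.snoc y t : Fin (n + 1) → ℕ) j.castSucc = (Fin.snoc w s : Fin (n + 1) → ℕ) _
      rw [Fin.snoc_castSucc, Fin.snoc_castSucc]
      exact hi j (Fin.castSucc_lt_castSucc_iff.1 hj)
  · change (Fin.snoc y t : Fin (n + 1) → ℕ) i.castSucc < (Fin.snoc w s : Fin (n + 1) → ℕ) _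
    rw [Fin.snoc_castSucc, Fin.snoc_castSucc]
    exact hi'

theorem card_slice (V : Finset (Fin (n + 1) → ℕ)) (t : ℕ) :
    (slice V t).card = (V.filter fun u => u (Fin.last n) = t).card :=
  Finset.card_image_of_injOn (init_injOn V t)

/-- A sum over `V`, slice by slice. -/
theorem sum_slice {M : Type*} [AddCommMonoid M] {e : Fin (n + 1) → ℕ∞} {d : ℕ}
    {V : Finset (Fin (n + 1) → ℕ)} (hV : V ⊆ box e d) (f : (Fin (n + 1) → ℕ) → M) :
    ∑ u ∈ V, f u =
      ∑ t ∈ Finset.range (d + 1), ∑ y ∈ slice V t, f (Fin.snoc y t : Fin (n + 1) → ℕ) := by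
  have hmaps : ∀ u ∈ V, u (Fin.last n) ∈ Finset.range (d + 1) := fun u hu => by
    have h := hV hu
    rw [← Fin.snoc_init_self u] at h
    exact Finset.mem_range.2 (Nat.lt_succ_of_le (snoc_mem_box.1 h).1)
  rw [← Finset.sum_fiberwise_of_maps_to hmaps]
  refine Finset.sum_congr rfl fun t _ => ?_
  rw [slice, Finset.sum_image (init_injOn V t)]
  refine Finset.sum_congr rfl fun u hu => ?_
  rw [← (Finset.mem_filter.1 hu).2, Fin.snoc_init_self]

theorem sum_card_slice {e : Fin (n + 1) → ℕ∞} {d : ℕ} {V : Finset (Fin (n + 1) → ℕ)}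
    (hV : V ⊆ box e d) : V.card = ∑ t ∈ Finset.range (d + 1), (slice V t).card := by
  simpa only [Finset.card_eq_sum_ones] using sum_slice hV fun _ => 1

theorem slice_subset_box {e : Fin (n + 1) → ℕ∞} {d t : ℕ} {V : Finset (Fin (n + 1) → ℕ)}
    (hV : V ⊆ box e d) : slice V t ⊆ box (Fin.init e) (d - t) :=
  fun _ hy => (snoc_mem_box.1 (hV (mem_slice.1 hy))).2.2

theorem isBorel_slice {e : Fin (n + 1) → ℕ∞} {V : Finset (Fin (n + 1) → ℕ)}
    (hV : IsBorel e V) (t : ℕ) : IsBorel (Fin.init e) (slice V t) := by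
  intro y hy p q hpq hq hp
  have := hV _ (mem_slice.1 hy) p.castSucc q.castSucc (by simpa using hpq) (by simpa using hq)
    (by simpa [Fin.init] using hp)
  rwa [snoc_sub_single_castSucc, snoc_add_single_castSucc, ← mem_slice] at this

theorem isLexSet_slice {e : Fin (n + 1) → ℕ∞} {d : ℕ} {L : Finset (Fin (n + 1) → ℕ)}
    (hL : IsLexSet e d L) (t : ℕ) : IsLexSet (Fin.init e) (d - t) (slice L t) := by
  refine ⟨slice_subset_box hL.1, fun v hv u hu hlt => ?_⟩
  have hv := mem_slice.1 hv
  have hb := snoc_mem_box.1 (hL.1 hv)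
  exact mem_slice.2 (hL.2 _ hv _ (snoc_mem_box.2 ⟨hb.1, hb.2.1, hu⟩) (toLex_snoc_lt hlt))

/-- Exchanging the last variable for an earlier one moves a Borel set one slice down. -/
theorem shadow_slice_subset {e : Fin (n + 1) → ℕ∞} {V : Finset (Fin (n + 1) → ℕ)}
    (hV : IsBorel e V) (d t : ℕ) :
    shadow (Fin.init e) d (slice V (t + 1)) ⊆ slice V t := by
  intro w hw
  obtain ⟨hwb, y, hy, p, rfl⟩ := mem_shadow.1 hw
  have := hV _ (mem_slice.1 hy) p.castSucc (Fin.last n) (Fin.castSucc_lt_last p) (by simp)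
    (by simpa [Fin.init] using (mem_box.1 hwb).2 p)
  rwa [snoc_sub_single_last, snoc_add_single_castSucc, ← mem_slice] at this

theorem slice_shadow_zero (e : Fin (n + 1) → ℕ∞) (he : 0 < e (Fin.last n)) (d : ℕ)
    (V : Finset (Fin (n + 1) → ℕ)) :
    slice (shadow e d V) 0 = shadow (Fin.init e) d (slice V 0) := by
  ext w
  rw [mem_slice, mem_shadow, mem_shadow, snoc_mem_box]
  constructor
  · rintro ⟨⟨-, -, hb⟩, u, hu, p, hw⟩
    refine ⟨hb, ?_⟩
    induction p using Fin.lastCases with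
    | last => simpa using congrFun hw (Fin.last n)
    | cast p =>
      rw [← Fin.snoc_init_self u, snoc_add_single_castSucc] at hw
      obtain ⟨h1, h2⟩ := Fin.snoc_inj.1 hw
      refine ⟨Fin.init u, ?_, p, h1⟩
      rw [mem_slice, h2, Fin.snoc_init_self]
      exact hu
  · rintro ⟨hb, y, hy, p, rfl⟩
    exact ⟨⟨by omega, by simpa using he, hb⟩, _, mem_slice.1 hy, p.castSucc,
      (snoc_add_single_castSucc _ _ _).symm⟩

theorem slice_shadow_succ {e : Fin (n + 1) → ℕ∞} {d t : ℕ} {V : Finset (Fin (n + 1) → ℕ)}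
    (hV : V ⊆ box e d) (hB : IsBorel e V) (ht : ((t + 1 : ℕ) : ℕ∞) < e (Fin.last n)) :
    slice (shadow e d V) (t + 1) = slice V t := by
  ext w
  rw [mem_slice, mem_shadow, snoc_mem_box]
  constructor
  · rintro ⟨⟨-, -, hb⟩, u, hu, p, hw⟩
    induction p using Fin.lastCases with
    | last =>
      rw [← Fin.snoc_init_self u, snoc_add_single_last] at hw
      obtain ⟨h1, h2⟩ := Fin.snoc_inj.1 hw
      rw [mem_slice, h1, Nat.succ_injective h2, Fin.snoc_init_self]
      exact hu
    | cast p =>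
      rw [← Fin.snoc_init_self u, snoc_add_single_castSucc] at hw
      obtain ⟨h1, h2⟩ := Fin.snoc_inj.1 hw
      refine shadow_slice_subset hB (d - (t + 1)) t (mem_shadow.2 ⟨?_, Fin.init u, ?_, p, h1⟩)
      · have := (mem_box.1 hb).1
        have hd := (mem_box.1 (hV hu)).1
        rw [← Fin.snoc_init_self u, sum_snoc, ← h2] at hd
        rw [h1, sum_add_single] at this
        refine mem_box_of_le hb le_rfl ?_
        rw [h1, sum_add_single]
        omega
      · rw [mem_slice, h2, Fin.snoc_init_self]
        exact hu
  · intro hw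
    have hw := mem_slice.1 hw
    have hb := snoc_mem_box.1 (hV hw)
    refine ⟨⟨by omega, ht, ?_⟩, _, hw, Fin.last n, (snoc_add_single_last _ _).symm⟩
    rw [Nat.succ_sub_succ]
    exact hb.2.2

end Slices

/-! ### The Clements–Lindström inequality for Borel sets -/

section ClementsLindstrom

variable {n : ℕ}

/-- Lexicographic segments have the smallest shadows among the Borel sets that are at least as
large (the Clements–Lindström inequality for Borel sets). -/
def ShadowBound (e : Fin n → ℕ∞) : Prop :=
  ∀ (d : ℕ) (V L : Finset (Fin n → ℕ)), V ⊆ box e d → IsBorel e V → IsLexSet e d L →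
    L.card ≤ V.card → (shadow e d L).card ≤ (shadow e d V).card

/-- If some slice of a Borel set `V` is larger than the corresponding slice of a lexicographic
segment `L`, then no lower slice of `V` is smaller than that of `L`: the words in the lower slices
of `L` have their prefixes in the segment obtained from the slice of `L` by adding one element, and
taking shadows transports this down to the slice in question. -/
theorem card_slice_le_of_lt {e : Fin (n + 1) → ℕ∞} (hS : ShadowBound (Fin.init e)) {d : ℕ}
    {V L : Finset (Fin (n + 1) → ℕ)} (hV : V ⊆ box e d) (hB : IsBorel e V) (hL : IsLexSet e d L)
    {t t' : ℕ} (htt : t ≤ t') (h : (slice L t').card < (slice V t').card) :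
    (slice L t).card ≤ (slice V t).card := by
  obtain ⟨htd, hte⟩ : t' ≤ d ∧ (t' : ℕ∞) < e (Fin.last n) := by
    obtain ⟨y, hy⟩ := Finset.card_pos.1 (Nat.zero_lt_of_lt h)
    have := snoc_mem_box.1 (hV (mem_slice.1 hy))
    exact ⟨this.1, this.2.1⟩
  have key : ∀ k s, s + k = t' → ∃ X, IsLexSet (Fin.init e) (d - s) X ∧
      X.card ≤ (slice V s).card ∧ ∀ r ≤ s, ∀ y ∈ slice L r, ∀ y', IsPrefix y' y →
        ∑ i, y' i = d - s → y' ∈ X := by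
    intro k
    induction k with
    | zero =>
      rintro s rfl
      obtain ⟨w, hw, hX⟩ := (isLexSet_slice hL s).exists_insert
        (h.trans_le (Finset.card_le_card (slice_subset_box hV)))
      refine ⟨_, hX, by rwa [Finset.card_insert_of_notMem hw], fun r hr y hy y' hp hd => ?_⟩
      have hwX := Finset.mem_insert_self w (slice L s)
      refine hX.mem_of_not_lt hwX (mem_box_of_le (slice_subset_box hL.1 hy) hp.1 hd) fun hlt => ?_
      have hwb := hX.1 hwX
      have hlt' := hp.toLex_lt (hd.trans (mem_box.1 hwb).1.symm) hlt
      exact hw (mem_slice.2 (hL.2 _ (mem_slice.1 hy) _ (snoc_mem_box.2 ⟨htd, hte, hwb⟩)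
        (toLex_snoc_lt hlt')))
    | succ k ih =>
      intro s hs
      obtain ⟨X, hX, hc, hpre⟩ := ih (s + 1) (by omega)
      have hds : d - (s + 1) + 1 = d - s := by omega
      refine ⟨shadow (Fin.init e) (d - (s + 1)) X, hds ▸ isLexSet_shadow hX, ?_, ?_⟩
      · exact (hS _ _ _ (slice_subset_box hV) (isBorel_slice hB _) hX hc).trans
          (Finset.card_le_card (shadow_slice_subset hB _ _))
      · intro r hr y hy y' hp hd
        obtain ⟨q, hq, hlast⟩ := exists_last_ne_zero (w := y') (by omega)
        have hsum := sum_sub_single hq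
        refine mem_shadow.2 ⟨mem_box_of_le (slice_subset_box hL.1 hy) hp.1 (by omega),
          y' - Pi.single q 1, ?_, q, (sub_add_single hq).symm⟩
        exact hpre r (by omega) y hy _ (hp.sub_single hlast) (by omega)
  obtain ⟨X, -, hc, hpre⟩ := key (t' - t) t (by omega)
  refine (Finset.card_le_card fun y hy => ?_).trans hc
  exact hpre t le_rfl y hy y (IsPrefix.refl y) (mem_box.1 (slice_subset_box hL.1 hy)).1

/-- Two sequences that compare as the slice sizes in `card_slice_le_of_lt` have comparable
initial sums. -/
theorem sum_range_le_sum_range {l v : ℕ → ℕ} (h : ∀ t t', t ≤ t' → l t' < v t' → l t ≤ v t)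
    {m k : ℕ} (hk : k ≤ m) (hs : ∑ t ∈ Finset.range m, l t ≤ ∑ t ∈ Finset.range m, v t) :
    ∑ t ∈ Finset.range k, l t ≤ ∑ t ∈ Finset.range k, v t := by
  by_cases hex : ∃ t', k ≤ t' ∧ l t' < v t'
  · obtain ⟨t', hkt, hlt⟩ := hex
    exact Finset.sum_le_sum fun t ht => h t t' ((Finset.mem_range.1 ht).le.trans hkt) hlt
  · push Not at hex
    have h1 : ∑ t ∈ Finset.Ico k m, v t ≤ ∑ t ∈ Finset.Ico k m, l t :=
      Finset.sum_le_sum fun t ht => hex t (Finset.mem_Ico.1 ht).1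
    rw [← Finset.sum_range_add_sum_Ico l hk, ← Finset.sum_range_add_sum_Ico v hk] at hs
    omega

theorem sum_card_slice_le {e : Fin (n + 1) → ℕ∞} (hS : ShadowBound (Fin.init e)) {d : ℕ}
    {V L : Finset (Fin (n + 1) → ℕ)} (hV : V ⊆ box e d) (hB : IsBorel e V) (hL : IsLexSet e d L)
    (hc : L.card ≤ V.card) {k : ℕ} (hk : k ≤ d + 1) :
    ∑ t ∈ Finset.range k, (slice L t).card ≤ ∑ t ∈ Finset.range k, (slice V t).card :=
  sum_range_le_sum_range (fun _ _ htt h => card_slice_le_of_lt hS hV hB hL htt h) hk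
    (by rwa [← sum_card_slice hV, ← sum_card_slice hL.1])

theorem card_slice_zero_le {e : Fin (n + 1) → ℕ∞} (hS : ShadowBound (Fin.init e)) {d : ℕ}
    {V L : Finset (Fin (n + 1) → ℕ)} (hV : V ⊆ box e d) (hB : IsBorel e V) (hL : IsLexSet e d L)
    (hc : L.card ≤ V.card) : (slice L 0).card ≤ (slice V 0).card := by
  simpa using sum_card_slice_le hS hV hB hL hc (k := 1) (by omega)

theorem exists_range_eq_filter (c : ℕ∞) (d : ℕ) : ∃ k ≤ d + 1,
    (Finset.range (d + 1)).filter (fun t => ((t + 1 : ℕ) : ℕ∞) < c) = Finset.range k := by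
  induction c using ENat.recTopCoe with
  | top =>
    refine ⟨d + 1, le_rfl, Finset.filter_true_of_mem fun t _ => ENat.natCast_lt_top _⟩
  | coe c =>
    refine ⟨min (d + 1) (c - 1), by omega, ?_⟩
    ext t
    simp only [Finset.mem_filter, Finset.mem_range, Nat.cast_lt]
    omega

/-- The shadow of a Borel set in terms of its slices: multiplication by the last variable fills
the positive slices, and the other variables contribute nothing new there. -/
theorem card_shadow {e : Fin (n + 1) → ℕ∞} (he : 0 < e (Fin.last n)) {d : ℕ}
    {V : Finset (Fin (n + 1) → ℕ)} (hV : V ⊆ box e d) (hB : IsBorel e V) :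
    (shadow e d V).card = (shadow (Fin.init e) d (slice V 0)).card +
      ∑ t ∈ (Finset.range (d + 1)).filter (fun t => ((t + 1 : ℕ) : ℕ∞) < e (Fin.last n)),
        (slice V t).card := by
  have hsub : shadow e d V ⊆ box e (d + 1) := Finset.filter_subset _ _
  rw [sum_card_slice hsub, Finset.sum_range_succ', slice_shadow_zero e he, add_comm,
    Finset.sum_filter]
  congr 1
  refine Finset.sum_congr rfl fun t _ => ?_
  split_ifs with h
  · rw [slice_shadow_succ hV hB h]
  · rw [Finset.card_eq_zero, Finset.eq_empty_iff_forall_notMem]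
    exact fun y hy => h (snoc_mem_box.1 (hsub (mem_slice.1 hy))).2.1

theorem shadowBound (e : Fin n → ℕ∞) (he : ∀ p, 0 < e p) : ShadowBound e := by
  induction n with
  | zero =>
    intro d V L _ _ _ _
    have : shadow e d L = ∅ := Finset.eq_empty_iff_forall_notMem.2 fun w hw => by
      obtain ⟨-, -, -, p, -⟩ := mem_shadow.1 hw
      exact p.elim0
    simp [this]
  | succ n ih =>
    intro d V L hV hB hL hc
    have hS := ih (Fin.init e) fun p => he _
    rw [card_shadow (he _) hV hB, card_shadow (he _) hL.1 hL.isBorel]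
    refine add_le_add ?_ ?_
    · exact hS d _ _ (slice_subset_box hV) (isBorel_slice hB 0) (isLexSet_slice hL 0)
        (card_slice_zero_le hS hV hB hL hc)
    · obtain ⟨k, hk, hk'⟩ := exists_range_eq_filter (e (Fin.last n)) d
      rw [hk']
      exact sum_card_slice_le hS hV hB hL hc hk

end ClementsLindstrom

/-! ### Weights of monomials and their maximum on lexicographic segments -/

section Weight

/-- The number of `i`-element sets of variables that contribute a Koszul cycle to the monomial with
exponent `u` (see `card_filter_isGood`), given by recursion on the last variable. -/
def weight : (n : ℕ) → (Fin n → ℕ∞) → (Fin n → ℕ) → ℕ → ℕ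
  | 0, _, _, _ => 0
  | n + 1, e, u, i =>
    if u (Fin.last n) = 0 then weight n (Fin.init e) (Fin.init u) i
    else n.choose i +
      if ((u (Fin.last n) + 1 : ℕ) : ℕ∞) = e (Fin.last n) then
        match i with
        | 0 => 0
        | i + 1 => weight n (Fin.init e) (Fin.init u) i
      else 0

theorem weight_le_choose {n : ℕ} (e : Fin n → ℕ∞) (u : Fin n → ℕ) (i : ℕ) :
    weight n e u i ≤ n.choose i := by
  induction n generalizing i with
  | zero => simp [weight]
  | succ n ih =>
    simp only [weight]
    split_ifs with h h'
    · exact (ih _ _ i).trans (Nat.choose_le_choose i n.le_succ)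
    · cases i with
      | zero => simp
      | succ i =>
        rw [Nat.choose_succ_succ, add_comm]
        exact Nat.add_le_add_right (ih _ _ i) _
    · simpa using Nat.choose_le_choose i n.le_succ

variable {n : ℕ}

/-- The number of cycles lost when a lexicographic segment shrinks is bounded by the number of
elements lost times the largest possible weight. -/
theorem IsLexSet.sum_weight_le {e : Fin n → ℕ∞} {d : ℕ} {L M : Finset (Fin n → ℕ)}
    (hL : IsLexSet e d L) (hM : IsLexSet e d M) (h : L.card ≤ M.card) (i : ℕ) :
    ∑ u ∈ M, weight n e u i ≤ ∑ u ∈ L, weight n e u i + n.choose i * (M.card - L.card) := by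
  have hsub := hL.subset_of_card_le hM h
  rw [← Finset.sum_sdiff hsub, add_comm, ← Finset.card_sdiff_of_subset hsub]
  refine Nat.add_le_add_left ?_ _
  have := Finset.sum_le_card_nsmul (M \ L) (fun u => weight n e u i) (n.choose i)
    fun u _ => weight_le_choose e u i
  simpa [mul_comm] using this

/-- The total weight of a Borel set, by slices. -/
theorem sum_weight_eq {e : Fin (n + 1) → ℕ∞} {d : ℕ} {V : Finset (Fin (n + 1) → ℕ)}
    (hV : V ⊆ box e d) (i : ℕ) :
    ∑ u ∈ V, weight (n + 1) e u i = ∑ y ∈ slice V 0, weight n (Fin.init e) y i +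
      (n.choose i * (V.card - (slice V 0).card) +
        ∑ t ∈ (Finset.range d).filter (fun t => ((t + 1 + 1 : ℕ) : ℕ∞) = e (Fin.last n)),
          match i with
          | 0 => 0
          | i + 1 => ∑ y ∈ slice V (t + 1), weight n (Fin.init e) y i) := by
  have h0 : V.card - (slice V 0).card = ∑ t ∈ Finset.range d, (slice V (t + 1)).card := by
    rw [sum_card_slice hV, Finset.sum_range_succ', Nat.add_sub_cancel]
  rw [sum_slice hV, Finset.sum_range_succ', add_comm, h0, Finset.mul_sum, Finset.sum_filter,
    ← Finset.sum_add_distrib]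
  congr 1
  · exact Finset.sum_congr rfl fun y _ => by simp [weight]
  · refine Finset.sum_congr rfl fun t _ => ?_
    simp only [weight, Fin.snoc_last, Fin.init_snoc, Finset.sum_add_distrib, if_neg t.succ_ne_zero,
      Finset.sum_const, smul_eq_mul, mul_comm]
    congr 1
    split_ifs
    · cases i <;> simp
    · simp

/-- Among the Borel sets of a given size in a given degree, the lexicographic segment has the
largest total weight. -/
theorem sum_weight_le {e : Fin n → ℕ∞} (he : ∀ p, 0 < e p) {d : ℕ} {V L : Finset (Fin n → ℕ)}
    (hV : V ⊆ box e d) (hB : IsBorel e V) (hL : IsLexSet e d L) (hc : V.card = L.card) (i : ℕ) :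
    ∑ u ∈ V, weight n e u i ≤ ∑ u ∈ L, weight n e u i := by
  induction n generalizing d i with
  | zero => simp [weight]
  | succ n ih =>
    have hS := shadowBound (Fin.init e) fun p => he _
    have h0 := card_slice_zero_le hS hV hB hL hc.ge
    -- a slice of `V` compared with the lexicographic segment of the same size
    have hcmp : ∀ t i, ∃ M, IsLexSet (Fin.init e) (d - t) M ∧ M.card = (slice V t).card ∧
        ∑ y ∈ slice V t, weight n (Fin.init e) y i ≤ ∑ y ∈ M, weight n (Fin.init e) y i := by
      intro t i
      obtain ⟨M, hM, hMc⟩ :=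
        exists_isLexSet_card (Finset.card_le_card (slice_subset_box hV (t := t)))
      exact ⟨M, hM, hMc,
        ih (fun p => he _) (slice_subset_box hV) (isBorel_slice hB t) hM hMc.symm i⟩
    rw [sum_weight_eq hV, sum_weight_eq hL.1, ← add_assoc, ← add_assoc]
    refine add_le_add ?_ (Finset.sum_le_sum fun t ht => ?_)
    · obtain ⟨M, hM, hMc, hle⟩ := hcmp 0 i
      have := (isLexSet_slice hL 0).sum_weight_le hM (by omega) i
      have hV0 : (slice V 0).card ≤ V.card := by
        rw [card_slice]; exact Finset.card_filter_le _ _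
      have hsplit : L.card - (slice L 0).card =
          ((slice V 0).card - (slice L 0).card) + (V.card - (slice V 0).card) := by omega
      rw [hsplit, mul_add, ← add_assoc, ← hMc]
      exact Nat.add_le_add_right (hle.trans this) _
    · obtain ⟨htd, hte⟩ := Finset.mem_filter.1 ht
      rw [Finset.mem_range] at htd
      cases i with
      | zero => exact le_rfl
      | succ i =>
        -- the top slice of `L` is at least as large as that of `V`
        have htop : (slice V (t + 1)).card ≤ (slice L (t + 1)).card := by
          have h1 := sum_card_slice_le hS hV hB hL hc.ge (k := t + 1) (by omega)
          have hsum : ∀ W ⊆ box e d, W.card =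
              ∑ s ∈ Finset.range (t + 1), (slice W s).card + (slice W (t + 1)).card := by
            intro W hW
            rw [sum_card_slice hW, ← Finset.sum_range_succ]
            refine (Finset.sum_subset (Finset.range_mono (by omega)) fun s _ hs => ?_).symm
            rw [Finset.card_eq_zero, Finset.eq_empty_iff_forall_notMem]
            intro y hy
            have := (snoc_mem_box.1 (hW (mem_slice.1 hy))).2.1
            rw [← hte, Nat.cast_lt] at this
            exact hs (Finset.mem_range.2 this)
          have h2 := hsum V hV
          have h3 := hsum L hL.1
          omega
        obtain ⟨M, hM, hMc, hle⟩ := hcmp (t + 1) i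
        exact hle.trans (Finset.sum_le_sum_of_subset
          (hM.subset_of_card_le (isLexSet_slice hL (t + 1)) (by omega)))

end Weight

/-! ### Koszul cycles of monomial ideals -/

section Koszul

/-- The exponents of the monomials of degree `z` in `m` variables. -/
def expsOfDeg (m : ℕ) : ℤ → Finset (Fin m →₀ ℕ)
  | .ofNat d => Finset.finsuppAntidiag Finset.univ d
  | .negSucc _ => ∅

variable {k : Type*} [Field k] {m : ℕ}

theorem mem_expsOfDeg {z : ℤ} {c : Fin m →₀ ℕ} : c ∈ expsOfDeg m z ↔ (c.degree : ℤ) = z := by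
  cases z with
  | ofNat d =>
    rw [expsOfDeg, Finset.mem_finsuppAntidiag, Finsupp.degree_eq_sum, Int.ofNat_eq_natCast,
      Nat.cast_inj]
    simp
  | negSucc d => simp only [expsOfDeg, Finset.notMem_empty, false_iff]; omega

theorem mem_forms {z : ℤ} {f : MvPolynomial (Fin m) k} :
    f ∈ forms k m z ↔ ∀ c ∈ f.support, (c.degree : ℤ) = z := by
  cases z with
  | ofNat d =>
    simp only [forms, mem_homogeneousSubmodule, IsHomogeneous, IsWeightedHomogeneous,
      mem_support_iff, Int.ofNat_eq_natCast, Nat.cast_inj, ← Pi.one_def,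
      Finsupp.degree_eq_weight_one]
  | negSucc d =>
    constructor
    · intro h
      have h : f = 0 := h
      simp [h]
    · intro h
      change f = 0
      ext c
      by_contra hc
      have := h c (mem_support_iff.2 hc)
      omega

/-- A subspace has dimension `#Γ` if coordinates indexed by `Γ` separate its points and take
independent values on it. -/
theorem exists_equiv_of_coords {M X : Type*} [AddCommGroup M] [Module k M] [DecidableEq X]
    (φ : X → M →ₗ[k] k) (W : Submodule k M) (Γ : Finset X)
    (hinj : ∀ f ∈ W, (∀ x ∈ Γ, φ x f = 0) → f = 0)
    (hsurj : ∀ x ∈ Γ, ∃ f ∈ W, ∀ y ∈ Γ, φ y f = if y = x then 1 else 0) :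
    Nonempty (W ≃ₗ[k] (Γ → k)) := by
  refine ⟨LinearEquiv.ofBijective (LinearMap.pi fun x : Γ => (φ x).comp W.subtype) ⟨?_, ?_⟩⟩
  · rw [← LinearMap.ker_eq_bot, LinearMap.ker_eq_bot']
    rintro ⟨f, hf⟩ h
    exact Subtype.ext (hinj f hf fun x hx => congrFun h ⟨x, hx⟩)
  · choose! w hw hw' using hsurj
    intro h
    refine ⟨∑ x : Γ, h x • ⟨w x, hw x x.2⟩, ?_⟩
    funext y
    simp only [map_sum, map_smul, LinearMap.pi_apply,
      LinearMap.comp_apply, Submodule.subtype_apply, smul_eq_mul]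
    rw [Finset.sum_eq_single y]
    · simp [hw' y y.2 y y.2]
    · intro x _ hxy
      rw [hw' x x.2 y y.2, if_neg fun h => hxy (Subtype.ext h.symm), mul_zero]
    · simp

theorem finrank_eq_card_of_coords {M X : Type*} [AddCommGroup M] [Module k M] [DecidableEq X]
    (φ : X → M →ₗ[k] k) (W : Submodule k M) (Γ : Finset X)
    (hinj : ∀ f ∈ W, (∀ x ∈ Γ, φ x f = 0) → f = 0)
    (hsurj : ∀ x ∈ Γ, ∃ f ∈ W, ∀ y ∈ Γ, φ y f = if y = x then 1 else 0) :
    Module.finrank k W = Γ.card := by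
  obtain ⟨f⟩ := exists_equiv_of_coords φ W Γ hinj hsurj
  rw [f.finrank_eq, Module.finrank_pi, Fintype.card_coe]

/-- `E` is the set of exponents of the monomials in the monomial ideal `I`, and `I` consists of the
polynomials all of whose exponents lie in `E`. -/
def HasExponents (I : Ideal (MvPolynomial (Fin m) k)) (E : Set (Fin m →₀ ℕ)) : Prop :=
  ∀ f, f ∈ I ↔ ∀ c ∈ f.support, c ∈ E

variable {I : Ideal (MvPolynomial (Fin m) k)} {E : Set (Fin m →₀ ℕ)}

open Classical in
/-- The elements of degree `z` of a set of exponents. -/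
noncomputable def degPart (E : Set (Fin m →₀ ℕ)) (z : ℤ) : Finset (Fin m →₀ ℕ) :=
  (expsOfDeg m z).filter (· ∈ E)

theorem mem_degPart {z : ℤ} {c : Fin m →₀ ℕ} :
    c ∈ degPart E z ↔ (c.degree : ℤ) = z ∧ c ∈ E := by
  simp [degPart, mem_expsOfDeg]

theorem HasExponents.finrank_idealPart (hI : HasExponents I E) (z : ℤ) :
    Module.finrank k (idealPart I z) = (degPart E z).card := by
  classical
  refine finrank_eq_card_of_coords (fun c => lcoeff k c) _ _ (fun f hf h => ?_) fun c hc => ?_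
  · ext c
    by_contra hc
    have hc' := mem_support_iff.2 hc
    exact hc (h c (mem_degPart.2 ⟨mem_forms.1 hf.2 c hc', (hI f).1 hf.1 c hc'⟩))
  · obtain ⟨h1, h2⟩ := mem_degPart.1 hc
    refine ⟨monomial c 1, ⟨(hI _).2 fun a ha => ?_, mem_forms.2 fun a ha => ?_⟩, fun a _ => ?_⟩
    · rw [Finset.mem_singleton.1 (support_monomial_subset ha)]; exact h2
    · rw [Finset.mem_singleton.1 (support_monomial_subset ha)]; exact h1
    · simp [eq_comm]

/-- The exponent of the product of the variables in `σ`. -/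
noncomputable def setExp (σ : Finset (Fin m)) : Fin m →₀ ℕ := ∑ p ∈ σ, Finsupp.single p 1

theorem setExp_apply (σ : Finset (Fin m)) (p : Fin m) : setExp σ p = if p ∈ σ then 1 else 0 := by
  simp [setExp, Finsupp.finsetSum_apply, Finsupp.single_apply]

theorem setExp_insert {σ : Finset (Fin m)} {p : Fin m} (h : p ∉ σ) :
    setExp (insert p σ) = setExp σ + Finsupp.single p 1 := by
  rw [setExp, Finset.sum_insert h, add_comm, setExp]

/-- The pairs `(σ, c)` such that `x^c e_σ` lies in `(I ⊗ K_i)_j`, where `E` is the set of exponents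
of `I`; they index a basis. -/
noncomputable def pairs (E : Set (Fin m →₀ ℕ)) (i : ℕ) (j : ℤ) :
    Finset (Finset (Fin m) × (Fin m →₀ ℕ)) :=
  Finset.powersetCard i Finset.univ ×ˢ degPart E (j - i)

theorem mem_pairs {i : ℕ} {j : ℤ} {x : Finset (Fin m) × (Fin m →₀ ℕ)} :
    x ∈ pairs E i j ↔ x.1.card = i ∧ (x.2.degree : ℤ) = j - i ∧ x.2 ∈ E := by
  simp [pairs, mem_degPart]

/-- Given a choice of a variable `x_v`, `v = v(a)`, for each multidegree `a`, the pairs `(σ, c)`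
for which `e_σ` does not involve the variable chosen for the multidegree of `x^c e_σ`; the pair of
multidegree zero counts as good. -/
noncomputable def goodPairs (v : (Fin m →₀ ℕ) → Fin m) (E : Set (Fin m →₀ ℕ)) (i : ℕ) (j : ℤ) :
    Finset (Finset (Fin m) × (Fin m →₀ ℕ)) :=
  (pairs E i j).filter fun x => x.2 + setExp x.1 = 0 ∨ v (x.2 + setExp x.1) ∉ x.1

theorem HasExponents.mem_koszulChains (hI : HasExponents I E) {i : ℕ} {j : ℤ}
    {f : Finset (Fin m) → MvPolynomial (Fin m) k} :
    f ∈ koszulChains I i j ↔ ∀ σ c, coeff c (f σ) ≠ 0 → (σ, c) ∈ pairs E i j := by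
  constructor
  · intro h σ c hc
    obtain ⟨⟨h1, h2⟩, h3⟩ := h σ
    have hc' := mem_support_iff.2 hc
    refine mem_pairs.2 ⟨?_, mem_forms.1 h2 c hc', (hI _).1 h1 c hc'⟩
    by_contra hσ
    rw [h3 hσ] at hc
    exact hc (coeff_zero c)
  · intro h σ
    refine ⟨⟨(hI _).2 fun c hc => (mem_pairs.1 (h σ c (mem_support_iff.1 hc))).2.2,
      mem_forms.2 fun c hc => (mem_pairs.1 (h σ c (mem_support_iff.1 hc))).2.1⟩, fun hσ => ?_⟩
    ext c
    by_contra hc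
    exact hσ (mem_pairs.1 (h σ c hc)).1

/-- The coefficient of `x^c e_σ`. -/
noncomputable def coord (x : Finset (Fin m) × (Fin m →₀ ℕ)) :
    (Finset (Fin m) → MvPolynomial (Fin m) k) →ₗ[k] k :=
  (lcoeff k x.2).comp (LinearMap.proj x.1)

theorem coord_apply (x : Finset (Fin m) × (Fin m →₀ ℕ))
    (f : Finset (Fin m) → MvPolynomial (Fin m) k) : coord x f = coeff x.2 (f x.1) := rfl

theorem HasExponents.exists_equiv_koszulChains (hI : HasExponents I E) (i : ℕ) (j : ℤ) :
    Nonempty (koszulChains I i j ≃ₗ[k] (pairs E i j → k)) := by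
  classical
  have hcoord : ∀ (x : Finset (Fin m) × (Fin m →₀ ℕ)) (σ : Finset (Fin m)) (c : Fin m →₀ ℕ),
      coeff c ((Pi.single x.1 (monomial x.2 (1 : k)) :
        Finset (Fin m) → MvPolynomial (Fin m) k) σ) = if (σ, c) = x then 1 else 0 := by
    rintro ⟨ρ, b⟩ σ c
    by_cases hσ : σ = ρ
    · subst hσ; simp [eq_comm]
    · simp [hσ]
  refine exists_equiv_of_coords coord _ _ (fun f hf h => ?_) fun x hx => ?_
  · funext σ
    ext c
    by_contra hc
    exact hc (h (σ, c) (hI.mem_koszulChains.1 hf σ c hc))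
  · refine ⟨Pi.single x.1 (monomial x.2 1), hI.mem_koszulChains.2 fun σ c hc => ?_, fun y _ => ?_⟩
    · rw [hcoord] at hc
      rwa [show (σ, c) = x by by_contra h; exact hc (if_neg h)]
    · rw [coord_apply, hcoord]

/-- The dimension of the space of cycles in `I ⊗ K` for a monomial ideal `I` that is, with respect
to the chosen variables, stable: a cycle is determined by its coefficients at the good pairs, since
the equation `∂ f = 0` expresses the others by them; and these coefficients are arbitrary, since for
a good pair `(σ, c)` the boundary of `x^{c - v} e_{σ ∪ v}` lies in `I ⊗ K` and involves no other
good pair. -/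
theorem HasExponents.finrank_koszulCycles (hI : HasExponents I E) (v : (Fin m →₀ ℕ) → Fin m)
    (hv : ∀ a : Fin m →₀ ℕ, a ≠ 0 → a (v a) ≠ 0) (i : ℕ) (j : ℤ)
    (hE : ∀ (σ : Finset (Fin m)) (c : Fin m →₀ ℕ), c ∈ E → v (c + setExp σ) ∉ σ →
      c (v (c + setExp σ)) ≠ 0 → ∀ p ∈ σ,
        c - Finsupp.single (v (c + setExp σ)) 1 + Finsupp.single p 1 ∈ E) :
    Module.finrank k (koszulCycles I i j) = (goodPairs v E i j).card := by
  classical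
  refine finrank_eq_card_of_coords coord _ _ (fun f hf h => ?_) ?_
  · have hfP := hI.mem_koszulChains.1 hf.1
    have hf0 : koszulD k m f = 0 := hf.2
    have hgood : ∀ σ c, v (c + setExp σ) ∉ σ → coeff c (f σ) = 0 := fun σ c hvσ => by
      by_contra hc
      exact hc (h (σ, c) (Finset.mem_filter.2 ⟨hfP σ c hc, Or.inr hvσ⟩))
    funext σ
    ext c
    by_contra hc
    have hvσ : v (c + setExp σ) ∈ σ := by
      by_contra hvσ
      exact hc (hgood σ c hvσ)
    have key := coeff_koszulD f (σ.erase (v (c + setExp σ)))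
      (c + Finsupp.single (v (c + setExp σ)) 1)
    set a := c + setExp σ with ha
    have haσ : setExp (σ.erase (v a)) + Finsupp.single (v a) 1 = setExp σ := by
      rw [← setExp_insert (Finset.notMem_erase _ _), Finset.insert_erase hvσ]
    rw [hf0, Pi.zero_apply, coeff_zero, Finset.sum_eq_single (v a)] at key
    · rw [Finset.insert_erase hvσ, add_tsub_cancel_right, if_pos (by simp)] at key
      rcases mul_eq_zero.1 key.symm with h1 | h1
      · exact absurd h1 (pow_ne_zero _ (by simp))
      · exact hc h1
    · intro l hl hlv
      split_ifs with h0
      · rw [hgood, mul_zero]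
        have hl' : l ∉ σ.erase (v a) := Finset.mem_compl.1 hl
        have : c + Finsupp.single (v a) 1 - Finsupp.single l 1 +
            setExp (insert l (σ.erase (v a))) = a := by
          rw [setExp_insert hl', add_comm (setExp _), ← add_assoc,
            tsub_add_cancel_of_le (Finsupp.single_le_iff.2 (Nat.one_le_iff_ne_zero.2 h0)),
            add_assoc, add_comm (Finsupp.single _ _), haσ]
        rw [this]
        simp [hlv.symm]
      · rw [mul_zero]
    · intro hcon
      simp at hcon
  · rintro ⟨σ, c⟩ hx
    obtain ⟨hxP, hx0⟩ := Finset.mem_filter.1 hx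
    obtain ⟨hσ, hdeg, hcE⟩ := mem_pairs.1 hxP
    dsimp only at hx0 hσ hdeg hcE
    by_cases h0 : c + setExp σ = 0
    · -- in multidegree zero there is only the element `1 ∈ K_0`
      obtain ⟨hc0, hs0⟩ := add_eq_zero.1 h0
      have hσ0 : σ = ∅ := by
        refine Finset.eq_empty_iff_forall_notMem.2 fun p hp => ?_
        have := DFunLike.congr_fun hs0 p
        simp [setExp_apply, hp] at this
      subst hc0 hσ0
      refine ⟨Pi.single ∅ (monomial 0 1), ⟨hI.mem_koszulChains.2 fun τ b hb => ?_, ?_⟩, ?_⟩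
      · by_cases hτ : τ = ∅
        · subst hτ
          rw [Pi.single_eq_same, coeff_monomial] at hb
          have : (0 : Fin m →₀ ℕ) = b := by by_contra h; exact hb (if_neg h)
          rwa [← this]
        · rw [Pi.single_eq_of_ne hτ, coeff_zero] at hb
          exact absurd rfl hb
      · refine LinearMap.mem_ker.2 (funext fun τ => ?_)
        change ∑ l ∈ τᶜ, _ = _
        refine Finset.sum_eq_zero fun l _ => ?_
        rw [Pi.single_eq_of_ne (Finset.insert_ne_empty l τ), mul_zero, mul_zero]
      · rintro ⟨τ, b⟩ -
        rw [coord_apply]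
        by_cases hτ : τ = ∅
        · subst hτ
          rw [Pi.single_eq_same, coeff_monomial]
          simp [eq_comm]
        · simp [hτ]
    · have hvσ := hx0.resolve_left h0
      have hva := hv _ h0
      obtain ⟨w, hw⟩ : ∃ w, w = v (c + setExp σ) := ⟨_, rfl⟩
      have hstep := hE σ c hcE hvσ
      rw [← hw] at hvσ hva hstep
      have hcw : c w ≠ 0 := by simpa [setExp_apply, hvσ] using hva
      have hle : Finsupp.single w 1 ≤ c := Finsupp.single_le_iff.2 (Nat.one_le_iff_ne_zero.2 hcw)
      -- the boundary of `x^{c - w} e_{σ ∪ w}`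
      set g : Finset (Fin m) → MvPolynomial (Fin m) k :=
        Pi.single (insert w σ) (monomial (c - Finsupp.single w 1) 1) with hg
      have hgc : ∀ τ b, coeff b (koszulD k m g τ) ≠ 0 → ∃ l ∉ τ, insert l τ = insert w σ ∧
          b = c - Finsupp.single w 1 + Finsupp.single l 1 := by
        intro τ b hb
        rw [coeff_koszulD] at hb
        obtain ⟨l, hl, hl'⟩ := Finset.exists_ne_zero_of_sum_ne_zero hb
        have hl0 : b l ≠ 0 := by
          intro h; simp [h] at hl'
        rw [if_pos hl0] at hl'
        have hins : insert l τ = insert w σ := by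
          by_contra h
          rw [hg, Pi.single_eq_of_ne h, coeff_zero, mul_zero] at hl'
          exact hl' rfl
        rw [hg, hins, Pi.single_eq_same, coeff_monomial] at hl'
        have hb' : c - Finsupp.single w 1 = b - Finsupp.single l 1 := by
          by_contra h
          rw [if_neg h, mul_zero] at hl'
          exact hl' rfl
        refine ⟨l, by simpa using hl, hins, ?_⟩
        rw [hb', tsub_add_cancel_of_le (Finsupp.single_le_iff.2 (Nat.one_le_iff_ne_zero.2 hl0))]
      have hmain : coeff c (koszulD k m g σ) = (-1) ^ (σ.filter (· < w)).card := by
        rw [coeff_koszulD, Finset.sum_eq_single w, if_pos hcw, hg, Pi.single_eq_same,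
          coeff_monomial, if_pos rfl, mul_one]
        · intro l hl hlw
          rw [hg, Pi.single_eq_of_ne, coeff_zero, ite_self, mul_zero]
          intro h
          have : l ∈ insert w σ := h ▸ Finset.mem_insert_self l σ
          simp only [Finset.mem_compl] at hl
          exact (Finset.mem_insert.1 this).elim hlw hl
        · intro h; simp [hvσ] at h
      refine ⟨((-1 : k) ^ (σ.filter (· < w)).card) • koszulD k m g,
        Submodule.smul_mem _ _ ⟨hI.mem_koszulChains.2 fun τ b hb => ?_, koszulD_koszulD g⟩, ?_⟩
      · obtain ⟨l, hl, hins, rfl⟩ := hgc τ b hb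
        refine mem_pairs.2 ⟨?_, ?_, ?_⟩
        · have h1 := congrArg Finset.card hins
          rw [Finset.card_insert_of_notMem hl, Finset.card_insert_of_notMem hvσ] at h1
          dsimp only
          omega
        · have h1 := congrArg Finsupp.degree (tsub_add_cancel_of_le hle)
          simp only [map_add, Finsupp.degree_single] at h1 ⊢
          omega
        · rcases Finset.mem_insert.1 (hins ▸ Finset.mem_insert_self l τ) with rfl | hlσ
          · dsimp only; rwa [tsub_add_cancel_of_le hle]
          · exact hstep hcw l hlσ
      · rintro ⟨τ, b⟩ hy
        rw [map_smul, coord_apply, smul_eq_mul]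
        split_ifs with heq
        · obtain ⟨rfl, rfl⟩ := Prod.mk.inj heq
          rw [hmain, ← mul_pow]; simp
        · rw [mul_eq_zero]
          right
          by_contra hb
          obtain ⟨l, hl, hins, hb'⟩ := hgc τ b hb
          have hlw : l ≠ w := by
            rintro rfl
            refine heq (Prod.ext ?_ ?_)
            · have := congrArg (·.erase l) hins
              simpa [Finset.erase_insert hl, Finset.erase_insert hvσ] using this
            · dsimp only; rw [hb', tsub_add_cancel_of_le hle]
          have hwτ : w ∈ τ := by
            have : w ∈ insert l τ := hins ▸ Finset.mem_insert_self w σ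
            exact (Finset.mem_insert.1 this).resolve_left hlw.symm
          have hdeg : b + setExp τ = c + setExp σ := by
            rw [hb', add_assoc, add_comm (Finsupp.single l 1), ← setExp_insert hl, hins,
              setExp_insert hvσ, add_comm (setExp σ), ← add_assoc, tsub_add_cancel_of_le hle]
          have hy' := (Finset.mem_filter.1 hy).2
          dsimp only at hy'
          rw [hdeg, ← hw] at hy'
          exact hy'.elim h0 fun h => h hwτ

/-- The Betti numbers in terms of the dimensions of the spaces of chains and of cycles. -/
theorem HasExponents.gradedBetti_add (hI : HasExponents I E) (i : ℕ) (j : ℤ) :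
    gradedBetti I i j + (pairs E (i + 1) j).card =
      Module.finrank k (koszulCycles I i j) + Module.finrank k (koszulCycles I (i + 1) j) := by
  have hfin : ∀ i, Module.Finite k (koszulChains I i j) := fun i => by
    obtain ⟨f⟩ := hI.exists_equiv_koszulChains i j
    exact Module.Finite.equiv f.symm
  have hfinZ : Module.Finite k (koszulCycles I i j) := by
    have := hfin i
    exact Submodule.finiteDimensional_inf_left _ _
  have hcard : Module.finrank k (koszulChains I (i + 1) j) = (pairs E (i + 1) j).card := by
    obtain ⟨f⟩ := hI.exists_equiv_koszulChains (i + 1) j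
    rw [f.finrank_eq, Module.finrank_pi, Fintype.card_coe]
  have h1 := Submodule.finrank_quotient_add_finrank
    ((koszulBoundaries I i j).submoduleOf (koszulCycles I i j))
  rw [(Submodule.submoduleOfEquivOfLe (koszulBoundaries_le I i j)).finrank_eq] at h1
  have := hfin (i + 1)
  have h2 := LinearMap.finrank_range_add_finrank_ker
    (((koszulD k m).restrictScalars k).domRestrict (koszulChains I (i + 1) j))
  rw [LinearMap.range_domRestrict, LinearMap.ker_domRestrict, hcard] at h2
  have h3 : Module.finrank k
      ((LinearMap.ker ((koszulD k m).restrictScalars k)).submoduleOf (koszulChains I (i + 1) j)) =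
      Module.finrank k (koszulCycles I (i + 1) j) := by
    rw [← Submodule.finrank_map_subtype_eq, Submodule.submoduleOf, Submodule.map_comap_subtype]
    rfl
  rw [Submodule.submoduleOf] at h3
  rw [h3] at h2
  unfold gradedBetti
  unfold koszulBoundaries at h1 ⊢
  omega

end Koszul

/-! ### Exponents of sums with powers of the variables -/

section Exponents

variable {k : Type*} [Field k] {m : ℕ}

/-- The exponents of the monomials in `(x_1^{e_1}, …, x_m^{e_m})`. -/
def powExps (e : Fin m → ℕ∞) : Set (Fin m →₀ ℕ) := {c | ∃ p, e p ≤ c p}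

theorem notMem_powExps {e : Fin m → ℕ∞} {c : Fin m →₀ ℕ} :
    c ∉ powExps e ↔ ∀ p, (c p : ℕ∞) < e p := by
  simp [powExps]

theorem isUpperSet_exponents (I : Ideal (MvPolynomial (Fin m) k)) : IsUpperSet (exponents I) := by
  intro a b hab ha
  have := I.mul_mem_left (monomial (b - a) (1 : k)) ha
  rwa [monomial_mul, mul_one, tsub_add_cancel_of_le hab] at this

theorem exponents_monomialIdeal {D : Set (Fin m →₀ ℕ)} (hD : IsUpperSet D) :
    exponents (monomialIdeal k D) = D := by
  ext c
  simp only [exponents, monomialIdeal, Set.mem_ofPred_eq, mem_ideal_span_monomial_image]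
  constructor
  · intro h
    obtain ⟨s, hs, hsc⟩ := h c (by simp)
    exact hD hsc hs
  · intro hc a ha
    rw [Finset.mem_singleton.1 (support_monomial_subset ha)]
    exact ⟨c, hc, le_rfl⟩

theorem powersIdeal_eq_monomialIdeal (e : Fin m → ℕ∞) :
    powersIdeal k e = monomialIdeal k {s | ∃ (p : Fin m) (d : ℕ), e p = d ∧ s = .single p d} := by
  rw [powersIdeal, monomialIdeal]
  congr 1
  ext f
  simp only [Set.mem_ofPred_eq, Set.mem_image]
  constructor
  · rintro ⟨p, d, h, rfl⟩
    exact ⟨_, ⟨p, d, h, rfl⟩, (X_pow_eq_monomial).symm⟩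
  · rintro ⟨_, ⟨p, d, h, rfl⟩, rfl⟩
    exact ⟨p, d, h, (X_pow_eq_monomial).symm⟩

theorem hasExponents_sup {D : Set (Fin m →₀ ℕ)} (hD : IsUpperSet D) (e : Fin m → ℕ∞) :
    HasExponents (monomialIdeal k D ⊔ powersIdeal k e) (D ∪ powExps e) := by
  intro f
  rw [powersIdeal_eq_monomialIdeal, monomialIdeal, monomialIdeal, ← Ideal.span_union,
    ← Set.image_union, mem_ideal_span_monomial_image]
  refine forall₂_congr fun c _ => ⟨?_, ?_⟩
  · rintro ⟨s, hs | ⟨p, d, hd, rfl⟩, hsc⟩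
    · exact Or.inl (hD hsc hs)
    · refine Or.inr ⟨p, ?_⟩
      rw [hd]
      exact_mod_cast Finsupp.single_le_iff.1 hsc
  · rintro (hc | ⟨p, hp⟩)
    · exact ⟨c, Or.inl hc, le_rfl⟩
    · obtain ⟨d, hd⟩ := ENat.ne_top_iff_exists.1 (ne_top_of_le_ne_top (ENat.natCast_ne_top _) hp)
      rw [← hd] at hp
      exact ⟨_, Or.inr ⟨p, d, hd.symm, rfl⟩, Finsupp.single_le_iff.2 (by exact_mod_cast hp)⟩

end Exponents

/-! ### Pivots and good sets -/

section Pivot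

variable {n : ℕ}

/-- The index of the last variable in `x^a` whose exponent differs from `e_p`; if there is none,
the index of the last variable in `x^a`, and an arbitrary value if `a = 0`. -/
noncomputable def pivot (e : Fin (n + 1) → ℕ∞) (a : Fin (n + 1) →₀ ℕ) : Fin (n + 1) :=
  if h : (a.support.filter fun p => (a p : ℕ∞) ≠ e p).Nonempty then
    (a.support.filter fun p => (a p : ℕ∞) ≠ e p).max' h
  else if h : a.support.Nonempty then a.support.max' h else 0

theorem apply_pivot_ne_zero (e : Fin (n + 1) → ℕ∞) (a : Fin (n + 1) →₀ ℕ) (ha : a ≠ 0) :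
    a (pivot e a) ≠ 0 := by
  have hne := Finsupp.support_nonempty_iff.2 ha
  unfold pivot
  split_ifs with h
  · exact Finsupp.mem_support_iff.1 (Finset.mem_filter.1 (Finset.max'_mem _ h)).1
  · exact Finsupp.mem_support_iff.1 (Finset.max'_mem _ hne)

theorem eq_of_pivot_lt {e : Fin (n + 1) → ℕ∞} {a : Fin (n + 1) →₀ ℕ} {p : Fin (n + 1)}
    (hp : a p ≠ 0) (h : pivot e a < p ∨ (a (pivot e a) : ℕ∞) = e (pivot e a)) :
    (a p : ℕ∞) = e p := by
  by_contra hne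
  have hmem : p ∈ a.support.filter fun p => (a p : ℕ∞) ≠ e p := by simp [hp, hne]
  have hpiv : pivot e a = (a.support.filter fun p => (a p : ℕ∞) ≠ e p).max' ⟨p, hmem⟩ :=
    dif_pos ⟨p, hmem⟩
  rcases h with h | h
  · rw [hpiv] at h
    exact absurd (Finset.le_max' _ _ hmem) (not_le.2 h)
  · have := Finset.max'_mem _ ⟨p, hmem⟩
    rw [← hpiv] at this
    exact (Finset.mem_filter.1 this).2 h

theorem pivot_eq {e : Fin (n + 1) → ℕ∞} {a : Fin (n + 1) →₀ ℕ} {v : Fin (n + 1)}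
    (hv : a v ≠ 0) (hv' : (a v : ℕ∞) ≠ e v) (h : ∀ p, v < p → a p ≠ 0 → (a p : ℕ∞) = e p) :
    pivot e a = v := by
  have hmem : v ∈ a.support.filter fun p => (a p : ℕ∞) ≠ e p := by simp [hv, hv']
  have hpiv : pivot e a = (a.support.filter fun p => (a p : ℕ∞) ≠ e p).max' ⟨v, hmem⟩ :=
    dif_pos ⟨v, hmem⟩
  rw [hpiv]
  refine le_antisymm (Finset.max'_le _ _ _ fun p hp => ?_) (Finset.le_max' _ _ hmem)
  obtain ⟨hp1, hp2⟩ := Finset.mem_filter.1 hp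
  by_contra hlt
  exact hp2 (h p (not_le.1 hlt) (Finsupp.mem_support_iff.1 hp1))

/-- A strongly stable ideal plus the powers of the variables is stable with respect to exchanges
of the pivot: an exchange for a later variable, or from a pivot with full exponent, ends in the
powers of the variables. -/
theorem exchange_pivot_mem {e : Fin (n + 1) → ℕ∞} {D : Set (Fin (n + 1) →₀ ℕ)}
    (hD : ∀ a ∈ D, ∀ q, a q ≠ 0 → ∀ p ≤ q, a - Finsupp.single q 1 + Finsupp.single p 1 ∈ D)
    (σ : Finset (Fin (n + 1))) (c : Fin (n + 1) →₀ ℕ) (hc : c ∈ D ∪ powExps e)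
    (hσ : pivot e (c + setExp σ) ∉ σ) (h0 : c (pivot e (c + setExp σ)) ≠ 0) (p : Fin (n + 1))
    (hp : p ∈ σ) :
    c - Finsupp.single (pivot e (c + setExp σ)) 1 + Finsupp.single p 1 ∈ D ∪ powExps e := by
  obtain ⟨a, ha⟩ : ∃ a, a = c + setExp σ := ⟨_, rfl⟩
  have hap : a p = c p + 1 := by simp [ha, setExp_apply, hp]
  obtain ⟨w, hw⟩ : ∃ w, w = pivot e a := ⟨_, rfl⟩
  rw [← ha, ← hw] at hσ h0 ⊢
  have haw : a w = c w := by simp [ha, setExp_apply, hσ]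
  have hpw : p ≠ w := fun h => hσ (h ▸ hp)
  have hfull : (w < p ∨ (a w : ℕ∞) = e w) →
      c - Finsupp.single w 1 + Finsupp.single p 1 ∈ D ∪ powExps e := fun h => by
    refine Or.inr ⟨p, ?_⟩
    rw [← eq_of_pivot_lt (e := e) (a := a) (p := p) (by omega) (by rwa [← hw]), hap]
    simp [hpw.symm]
  rcases hc with hc | ⟨r, hr⟩
  · rcases lt_or_gt_of_ne hpw with h | h
    · exact Or.inl (hD c hc w h0 p h.le)
    · exact hfull (Or.inl h)
  · by_cases hrw : r = w
    · subst hrw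
      rcases hr.eq_or_lt with h | h
      · exact hfull (Or.inr (by rw [haw, h]))
      · refine Or.inr ⟨r, ?_⟩
        obtain ⟨d, hd⟩ := ENat.ne_top_iff_exists.1 h.ne_top
        rw [← hd] at h ⊢
        rw [Nat.cast_lt] at h
        simp only [Finsupp.add_apply, Finsupp.tsub_apply, Finsupp.single_eq_same, Nat.cast_le]
        omega
    · refine Or.inr ⟨r, hr.trans ?_⟩
      simp [Ne.symm hrw]

/-- The condition on `σ` that the last variable in `x^u x^σ` whose exponent is not full exists and
does not lie in `σ`, for `x^u` outside the powers of the variables. -/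
def IsGood {n : ℕ} (e : Fin n → ℕ∞) (u : Fin n → ℕ) (σ : Finset (Fin n)) : Prop :=
  ∃ v, v ∉ σ ∧ u v ≠ 0 ∧ ∀ p, v < p →
    (u p = 0 ∧ p ∉ σ) ∨ (p ∈ σ ∧ ((u p + 1 : ℕ) : ℕ∞) = e p)

theorem pivot_notMem_iff {e : Fin (n + 1) → ℕ∞} {c : Fin (n + 1) →₀ ℕ}
    (hc : ∀ p, (c p : ℕ∞) < e p) {σ : Finset (Fin (n + 1))} (h0 : c + setExp σ ≠ 0) :
    pivot e (c + setExp σ) ∉ σ ↔ IsGood e c σ := by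
  have hval : ∀ p, (c + setExp σ) p = c p + if p ∈ σ then 1 else 0 := fun p => by
    rw [Finsupp.add_apply, setExp_apply]
  constructor
  · intro h
    have hne := apply_pivot_ne_zero e _ h0
    refine ⟨_, h, by simpa [hval, h] using hne, fun p hp => ?_⟩
    by_cases hp0 : (c + setExp σ) p = 0
    · rw [hval] at hp0
      by_cases hpσ : p ∈ σ
      · simp [hpσ] at hp0
      · exact Or.inl ⟨by omega, hpσ⟩
    · have := eq_of_pivot_lt hp0 (Or.inl hp)
      rw [hval] at this
      by_cases hpσ : p ∈ σ
      · rw [if_pos hpσ] at this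
        exact Or.inr ⟨hpσ, this⟩
      · rw [if_neg hpσ] at this
        exact absurd this (hc p).ne
  · rintro ⟨v, hv, hv0, h⟩
    rw [pivot_eq (v := v)]
    · exact hv
    · rw [hval]; omega
    · rw [hval, if_neg hv]
      exact (hc v).ne
    · intro p hp hp0
      rw [hval] at hp0 ⊢
      rcases h p hp with ⟨h1, h2⟩ | ⟨h1, h2⟩
      · simp [h1, h2] at hp0
      · rw [if_pos h1, h2]

theorem univ_eq_insert_last :
    (Finset.univ : Finset (Fin (n + 1))) =
      insert (Fin.last n) (Finset.univ.map Fin.castSuccEmb) := by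
  rw [Fin.univ_castSuccEmb, Finset.cons_eq_insert]

theorem last_notMem_map (σ : Finset (Fin n)) : Fin.last n ∉ σ.map Fin.castSuccEmb := by
  simp [ne_of_lt]

theorem card_filter_powersetCard_zero (P : Finset (Fin (n + 1)) → Prop) [DecidablePred P] :
    ((Finset.powersetCard 0 Finset.univ).filter P).card =
      ((Finset.powersetCard 0 (Finset.univ : Finset (Fin n))).filter
        fun σ => P (σ.map Fin.castSuccEmb)).card := by
  simp only [Finset.powersetCard_zero, Finset.filter_singleton, Finset.map_empty]
  by_cases h : P ∅ <;> simp [h]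

theorem card_filter_powersetCard_succ (P : Finset (Fin (n + 1)) → Prop) [DecidablePred P]
    (i : ℕ) :
    ((Finset.powersetCard (i + 1) Finset.univ).filter P).card =
      ((Finset.powersetCard (i + 1) (Finset.univ : Finset (Fin n))).filter
        fun σ => P (σ.map Fin.castSuccEmb)).card +
      ((Finset.powersetCard i (Finset.univ : Finset (Fin n))).filter
        fun σ => P (insert (Fin.last n) (σ.map Fin.castSuccEmb))).card := by
  rw [univ_eq_insert_last, Finset.powersetCard_succ_insert (last_notMem_map _),
    Finset.filter_union, Finset.card_union_of_disjoint]
  · rw [Finset.powersetCard_map, Finset.powersetCard_map, Finset.filter_map, Finset.card_map,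
      Finset.filter_image, Finset.card_image_of_injOn, Finset.filter_map, Finset.card_map]
    · rfl
    · intro a ha b hb hab
      obtain ⟨ha, -⟩ := Finset.mem_filter.1 ha
      obtain ⟨hb, -⟩ := Finset.mem_filter.1 hb
      obtain ⟨a, -, rfl⟩ := Finset.mem_map.1 ha
      obtain ⟨b, -, rfl⟩ := Finset.mem_map.1 hb
      have h : (insert (Fin.last n) (a.map Fin.castSuccEmb)).erase (Fin.last n) =
          (insert (Fin.last n) (b.map Fin.castSuccEmb)).erase (Fin.last n) :=
        congrArg (·.erase (Fin.last n)) hab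
      rwa [Finset.erase_insert (last_notMem_map a), Finset.erase_insert (last_notMem_map b)] at h
  · rw [Finset.disjoint_left]
    intro τ h1 h2
    obtain ⟨h1, -⟩ := Finset.mem_filter.1 h1
    obtain ⟨h2, -⟩ := Finset.mem_filter.1 h2
    obtain ⟨ρ, -, rfl⟩ := Finset.mem_image.1 h2
    have := (Finset.mem_powersetCard.1 h1).1 (Finset.mem_insert_self _ _)
    exact last_notMem_map _ this

theorem isGood_map_iff {e : Fin (n + 1) → ℕ∞} {u : Fin (n + 1) → ℕ} (σ : Finset (Fin n)) :
    IsGood e u (σ.map Fin.castSuccEmb) ↔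
      u (Fin.last n) ≠ 0 ∨ IsGood (Fin.init e) (Fin.init u) σ := by
  constructor
  · rintro ⟨v, hv, hv0, h⟩
    induction v using Fin.lastCases with
    | last => exact Or.inl hv0
    | cast v =>
      refine Or.inr ⟨v, by simpa using hv, hv0, fun p hp => ?_⟩
      simpa [Fin.init] using h p.castSucc (by simpa using hp)
  · intro h
    by_cases h0 : u (Fin.last n) = 0
    · obtain ⟨v, hv, hv0, h⟩ := h.resolve_left (not_not.2 h0)
      refine ⟨v.castSucc, by simpa using hv, hv0, fun p hp => ?_⟩
      induction p using Fin.lastCases with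
      | last => exact Or.inl ⟨h0, last_notMem_map σ⟩
      | cast p => simpa [Fin.init] using h p (by simpa using hp)
    · exact ⟨_, last_notMem_map σ, h0, fun p hp => absurd (Fin.le_last p) (not_le.2 hp)⟩

theorem isGood_insert_last_iff {e : Fin (n + 1) → ℕ∞} {u : Fin (n + 1) → ℕ} (σ : Finset (Fin n)) :
    IsGood e u (insert (Fin.last n) (σ.map Fin.castSuccEmb)) ↔
      ((u (Fin.last n) + 1 : ℕ) : ℕ∞) = e (Fin.last n) ∧ IsGood (Fin.init e) (Fin.init u) σ := by
  constructor
  · rintro ⟨v, hv, hv0, h⟩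
    induction v using Fin.lastCases with
    | last => simp at hv
    | cast v =>
      refine ⟨?_, v, ?_, hv0, fun p hp => ?_⟩
      · simpa using h (Fin.last n) (Fin.castSucc_lt_last v)
      · simpa [Fin.castSucc_ne_last] using hv
      · simpa [Fin.init, Fin.castSucc_ne_last] using h p.castSucc (by simpa using hp)
  · rintro ⟨hl, v, hv, hv0, h⟩
    refine ⟨v.castSucc, by simpa [Fin.castSucc_ne_last] using hv, hv0, fun p hp => ?_⟩
    induction p using Fin.lastCases with
    | last => exact Or.inr ⟨Finset.mem_insert_self _ _, hl⟩
    | cast p => simpa [Fin.init, Fin.castSucc_ne_last] using h p (by simpa using hp)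

open Classical in
theorem card_filter_isGood {n : ℕ} (e : Fin n → ℕ∞) (he : ∀ p, 2 ≤ e p) (u : Fin n → ℕ) (i : ℕ) :
    ((Finset.powersetCard i Finset.univ).filter (IsGood e u)).card = weight n e u i := by
  induction n generalizing i with
  | zero =>
    rw [weight, Finset.card_eq_zero, Finset.filter_eq_empty_iff]
    rintro σ - ⟨v, -⟩
    exact v.elim0
  | succ n ih =>
    have ih := ih (Fin.init e) (fun p => he _) (Fin.init u)
    have hlow : ∀ i, ((Finset.powersetCard i (Finset.univ : Finset (Fin n))).filter
        fun σ => IsGood e u (σ.map Fin.castSuccEmb)).card =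
        if u (Fin.last n) = 0 then weight n (Fin.init e) (Fin.init u) i else n.choose i := by
      intro i
      simp only [isGood_map_iff]
      split_ifs with h
      · simpa [h] using ih i
      · simp [h]
    have hhigh : ∀ i, ((Finset.powersetCard i (Finset.univ : Finset (Fin n))).filter
        fun σ => IsGood e u (insert (Fin.last n) (σ.map Fin.castSuccEmb))).card =
        if ((u (Fin.last n) + 1 : ℕ) : ℕ∞) = e (Fin.last n) then
          weight n (Fin.init e) (Fin.init u) i else 0 := by
      intro i
      simp only [isGood_insert_last_iff]
      split_ifs with h
      · simpa only [h, true_and] using ih i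
      · simp only [h, false_and, Finset.filter_false, Finset.card_empty]
    have hone : u (Fin.last n) = 0 → ((u (Fin.last n) + 1 : ℕ) : ℕ∞) ≠ e (Fin.last n) := by
      intro h hcon
      have := he (Fin.last n)
      rw [← hcon, h] at this
      exact absurd this (by norm_num)
    cases i with
    | zero =>
      rw [card_filter_powersetCard_zero, hlow]
      simp only [weight]
      split_ifs <;> simp
    | succ i =>
      rw [card_filter_powersetCard_succ, hlow, hhigh]
      simp only [weight]
      by_cases h : u (Fin.last n) = 0
      · rw [if_pos h, if_pos h, if_neg (hone h), add_zero]
      · rw [if_neg h, if_neg h]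

end Pivot

/-! ### Counting the good pairs -/

section Counting

variable {m n : ℕ}

open Classical in
/-- The monomials of degree `d` with exponent in `D` outside `(x_1^{e_1}, …, x_m^{e_m})`. -/
noncomputable def boxPart (e : Fin m → ℕ∞) (D : Set (Fin m →₀ ℕ)) (d : ℕ) :
    Finset (Fin m → ℕ) :=
  (box e d).filter fun u => Finsupp.equivFunOnFinite.symm u ∈ D

theorem mem_boxPart {e : Fin m → ℕ∞} {D : Set (Fin m →₀ ℕ)} {d : ℕ} {u : Fin m → ℕ} :
    u ∈ boxPart e D d ↔ u ∈ box e d ∧ Finsupp.equivFunOnFinite.symm u ∈ D := by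
  simp [boxPart]

theorem coe_mem_boxPart {e : Fin m → ℕ∞} {D : Set (Fin m →₀ ℕ)} {d : ℕ} {c : Fin m →₀ ℕ} :
    ⇑c ∈ boxPart e D d ↔ c.degree = d ∧ c ∉ powExps e ∧ c ∈ D := by
  rw [mem_boxPart, mem_box, notMem_powExps, Finsupp.equivFunOnFinite_symm_coe,
    Finsupp.degree_eq_sum, and_assoc]

theorem boxPart_subset_box (e : Fin m → ℕ∞) (D : Set (Fin m →₀ ℕ)) (d : ℕ) :
    boxPart e D d ⊆ box e d := fun _ hu => (mem_boxPart.1 hu).1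

theorem card_degPart (e : Fin m → ℕ∞) (D : Set (Fin m →₀ ℕ)) (d : ℕ) :
    (degPart (D ∪ powExps e) d).card = (degPart (powExps e) d).card + (boxPart e D d).card := by
  classical
  rw [← Finset.card_filter_add_card_filter_not (s := degPart (D ∪ powExps e) d)
    (fun c => c ∈ powExps e)]
  congr 1
  · congr 1
    ext c
    simp only [Finset.mem_filter, mem_degPart, Set.mem_union]
    tauto
  · refine Finset.card_nbij' (fun c => ⇑c) Finsupp.equivFunOnFinite.symm (fun c hc => ?_)
      (fun u hu => ?_) (fun c _ => by simp) fun u _ => by simp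
    · obtain ⟨hc1, hc2⟩ := Finset.mem_filter.1 hc
      obtain ⟨hd, hc1⟩ := mem_degPart.1 hc1
      exact coe_mem_boxPart.2 ⟨by exact_mod_cast hd, hc2, hc1.resolve_right hc2⟩
    · have hu : ⇑(Finsupp.equivFunOnFinite.symm u) ∈ boxPart e D d := by simpa using hu
      obtain ⟨h1, h2, h3⟩ := coe_mem_boxPart.1 hu
      exact Finset.mem_filter.2 ⟨mem_degPart.2 ⟨by exact_mod_cast h1, Or.inl h3⟩, h2⟩

theorem card_pairs (E : Set (Fin m →₀ ℕ)) (i : ℕ) (j : ℤ) :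
    (pairs E i j).card = m.choose i * (degPart E (j - i)).card := by
  rw [pairs, Finset.card_product, Finset.card_powersetCard, Finset.card_univ, Fintype.card_fin]

open Classical in
/-- The good pairs for a strongly stable ideal plus powers: those in the powers, and for each
further monomial of the ideal the number of its good sets. -/
theorem card_goodPairs (e : Fin (n + 1) → ℕ∞) (D : Set (Fin (n + 1) →₀ ℕ)) {i d : ℕ} {j : ℤ}
    (hd : j - i = d) :
    (goodPairs (pivot e) (D ∪ powExps e) i j).card =
      (goodPairs (pivot e) (powExps e) i j).card +
        ∑ u ∈ boxPart e D d, ((Finset.powersetCard i Finset.univ).filter fun σ =>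
          Finsupp.equivFunOnFinite.symm u + setExp σ = 0 ∨
            pivot e (Finsupp.equivFunOnFinite.symm u + setExp σ) ∉ σ).card := by
  rw [← Finset.card_filter_add_card_filter_not (s := goodPairs (pivot e) (D ∪ powExps e) i j)
    (fun x => x.2 ∈ powExps e)]
  congr 1
  · congr 1
    ext x
    simp only [goodPairs, Finset.mem_filter, mem_pairs, Set.mem_union]
    tauto
  · rw [Finset.card_eq_sum_card_fiberwise (t := boxPart e D d)
      (f := fun x : Finset (Fin (n + 1)) × (Fin (n + 1) →₀ ℕ) => ⇑x.2)]
    · refine Finset.sum_congr rfl fun u hu => ?_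
      set c := Finsupp.equivFunOnFinite.symm u with hc
      have hcu : ⇑c = u := by simp [hc]
      rw [← hcu] at hu ⊢
      obtain ⟨h1, h2, h3⟩ := coe_mem_boxPart.1 hu
      refine Finset.card_nbij' Prod.fst (fun σ => (σ, c)) ?_ ?_ ?_ fun σ _ => rfl
      · rintro ⟨σ, b⟩ hx
        simp only [goodPairs, Finset.coe_filter, Finset.mem_filter, Set.mem_ofPred_eq, mem_pairs,
          DFunLike.coe_fn_eq] at hx
        obtain ⟨⟨⟨hP, hg⟩, -⟩, rfl⟩ := hx
        exact Finset.mem_filter.2 ⟨Finset.mem_powersetCard_univ.2 hP.1, hg⟩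
      · intro σ hσ
        simp only [Finset.coe_filter, Set.mem_ofPred_eq, Finset.mem_powersetCard_univ] at hσ
        simp only [goodPairs, Finset.coe_filter, Finset.mem_filter, Set.mem_ofPred_eq, mem_pairs]
        exact ⟨⟨⟨⟨hσ.1, by rw [hd]; exact_mod_cast h1, Or.inl h3⟩, hσ.2⟩, h2⟩, trivial⟩
      · rintro ⟨σ, b⟩ hx
        have := (Finset.mem_filter.1 hx).2
        rw [DFunLike.coe_fn_eq] at this
        rw [← this]
    · rintro ⟨σ, b⟩ hx
      simp only [goodPairs, Finset.coe_filter, Finset.mem_filter, Set.mem_ofPred_eq, mem_pairs,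
        Set.mem_union] at hx
      obtain ⟨⟨⟨-, hdeg, hb⟩, -⟩, hb'⟩ := hx
      refine coe_mem_boxPart.2 ⟨?_, hb', hb.resolve_right hb'⟩
      rw [hd] at hdeg
      exact_mod_cast hdeg

open Classical in
theorem card_filter_pivot_eq_weight {e : Fin (n + 1) → ℕ∞} (he : ∀ p, 2 ≤ e p) {d : ℕ}
    (hd : d ≠ 0) {u : Fin (n + 1) → ℕ} (hu : u ∈ box e d) (i : ℕ) :
    ((Finset.powersetCard i Finset.univ).filter fun σ =>
      Finsupp.equivFunOnFinite.symm u + setExp σ = 0 ∨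
        pivot e (Finsupp.equivFunOnFinite.symm u + setExp σ) ∉ σ).card = weight (n + 1) e u i := by
  rw [← card_filter_isGood e he u i]
  obtain ⟨hs, hb⟩ := mem_box.1 hu
  congr 1
  refine Finset.filter_congr fun σ _ => ?_
  have h0 : Finsupp.equivFunOnFinite.symm u + setExp σ ≠ 0 := fun h => by
    have h := (add_eq_zero.1 h).1
    have h' : u = 0 := by
      rw [← Finsupp.coe_equivFunOnFinite_symm u, h, Finsupp.coe_zero]
    rw [h'] at hs
    simp at hs
    exact hd hs.symm
  rw [or_iff_right h0, pivot_notMem_iff (by simpa using hb) h0, Finsupp.coe_equivFunOnFinite_symm]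

/-- A lexicographic ideal has at least as many good pairs as a strongly stable one with the same
Hilbert function. -/
theorem card_goodPairs_le {e : Fin (n + 1) → ℕ∞} (he : ∀ p, 2 ≤ e p)
    {D D' : Set (Fin (n + 1) →₀ ℕ)} (hD : ∀ d, IsBorel e (boxPart e D d))
    (hD' : ∀ d, IsLexSet e d (boxPart e D' d))
    (hc : ∀ d, (boxPart e D d).card = (boxPart e D' d).card) (i : ℕ) (j : ℤ) :
    (goodPairs (pivot e) (D ∪ powExps e) i j).card ≤
      (goodPairs (pivot e) (D' ∪ powExps e) i j).card := by
  obtain ⟨d, hd⟩ | h := em (∃ d : ℕ, j - i = d)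
  · rw [card_goodPairs e D hd, card_goodPairs e D' hd]
    refine Nat.add_le_add_left ?_ _
    rcases eq_or_ne d 0 with rfl | hd0
    · -- in degree zero the two parts agree
      have hzero : ∀ V W : Finset (Fin (n + 1) → ℕ), V ⊆ box e 0 → W ⊆ box e 0 →
          V.card = W.card → V = W := fun V W hV hW h => by
        have hone : (box e 0).card ≤ 1 := Finset.card_le_one.2 fun u hu v hv => by
          have hu := (mem_box.1 hu).1
          have hv := (mem_box.1 hv).1
          rw [Finset.sum_eq_zero_iff] at hu hv
          funext p
          rw [hu p (Finset.mem_univ p), hv p (Finset.mem_univ p)]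
        rcases Nat.eq_zero_or_pos V.card with h0 | h0
        · exact (Finset.card_eq_zero.1 h0).trans (Finset.card_eq_zero.1 (h.symm.trans h0)).symm
        · rw [Finset.eq_of_subset_of_card_le hV (by omega),
            Finset.eq_of_subset_of_card_le hW (by omega)]
      rw [hzero _ _ (boxPart_subset_box e D 0) (boxPart_subset_box e D' 0) (hc 0)]
    · rw [Finset.sum_congr rfl fun u hu =>
          card_filter_pivot_eq_weight he hd0 (boxPart_subset_box e D d hu) i,
        Finset.sum_congr rfl fun u hu =>
          card_filter_pivot_eq_weight he hd0 (boxPart_subset_box e D' d hu) i]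
      exact sum_weight_le (fun p => lt_of_lt_of_le (by norm_num) (he p))
        (boxPart_subset_box e D d) (hD d) (hD' d) (hc d) i
  · have hempty : goodPairs (pivot e) (D ∪ powExps e) i j = ∅ :=
      Finset.eq_empty_iff_forall_notMem.2 fun x hx =>
        h ⟨x.2.degree, (mem_pairs.1 (Finset.mem_filter.1 hx).1).2.1.symm⟩
    simp [hempty]

end Counting

/-! ### Strongly stable and lexicographic ideals -/

section Ideals

variable {k : Type*} [Field k] {n : ℕ}

/-- The exchange property of the exponents of a strongly stable ideal. -/
def HasExchange (D : Set (Fin n →₀ ℕ)) : Prop :=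
  ∀ a ∈ D, ∀ q, a q ≠ 0 → ∀ p ≤ q, a - Finsupp.single q 1 + Finsupp.single p 1 ∈ D

theorem equivFunOnFinite_symm_exchange (u : Fin n → ℕ) (p q : Fin n) :
    Finsupp.equivFunOnFinite.symm (u - Pi.single q 1 + Pi.single p 1) =
      Finsupp.equivFunOnFinite.symm u - Finsupp.single q 1 + Finsupp.single p 1 := by
  ext i
  simp [Finsupp.single_apply, Pi.single_apply, eq_comm]

theorem HasExchange.isBorel {D : Set (Fin n →₀ ℕ)} (hD : HasExchange D) (e : Fin n → ℕ∞)
    (d : ℕ) : IsBorel e (boxPart e D d) := by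
  intro u hu p q hpq hq hp
  obtain ⟨hb, hu⟩ := mem_boxPart.1 hu
  refine mem_boxPart.2 ⟨exchange_mem_box hb hpq hq hp, ?_⟩
  rw [equivFunOnFinite_symm_exchange]
  exact hD _ hu q (by simpa using hq) p hpq.le

theorem degree_equivFunOnFinite_symm (u : Fin n → ℕ) :
    (Finsupp.equivFunOnFinite.symm u).degree = ∑ i, u i := by
  simp [Finsupp.degree_eq_sum]

theorem IsLexSegment.isLexSet {L : Ideal (MvPolynomial (Fin n) k)} (hL : IsLexSegment L)
    (e : Fin n → ℕ∞) (d : ℕ) : IsLexSet e d (boxPart e (exponents L) d) := by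
  refine ⟨boxPart_subset_box _ _ _, fun v hv u hu hlt => ?_⟩
  obtain ⟨hvb, hv⟩ := mem_boxPart.1 hv
  refine mem_boxPart.2 ⟨hu, hL.2 _ _ ?_ hlt hv⟩
  rw [degree_equivFunOnFinite_symm, degree_equivFunOnFinite_symm, (mem_box.1 hu).1,
    (mem_box.1 hvb).1]

theorem IsLexSegment.hasExchange {L : Ideal (MvPolynomial (Fin n) k)} (hL : IsLexSegment L) :
    HasExchange (exponents L) := by
  intro a ha q hq p hpq
  have hle : Finsupp.single q 1 ≤ a := Finsupp.single_le_iff.2 (Nat.one_le_iff_ne_zero.2 hq)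
  rcases hpq.eq_or_lt with rfl | hlt
  · rwa [tsub_add_cancel_of_le hle]
  · refine hL.2 _ a ?_ ?_ ha
    · have h1 := congrArg Finsupp.degree (tsub_add_cancel_of_le hle)
      simp only [map_add, Finsupp.degree_single] at h1 ⊢
      omega
    · have := toLex_lt_exchange (u := ⇑a) hlt
      rw [← Finsupp.single_eq_pi_single, ← Finsupp.single_eq_pi_single] at this
      exact this

/-- The Betti numbers of a strongly stable ideal plus powers in terms of numbers of pairs, which
do not involve the field. -/
theorem gradedBetti_add_card_pairs {J : Ideal (MvPolynomial (Fin (n + 1)) k)}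
    {D : Set (Fin (n + 1) →₀ ℕ)} (hJ : J = monomialIdeal k D) (hU : IsUpperSet D)
    (hD : HasExchange D) (e : Fin (n + 1) → ℕ∞) (i : ℕ) (j : ℤ) :
    gradedBetti (J ⊔ powersIdeal k e) i j + (pairs (D ∪ powExps e) (i + 1) j).card =
      (goodPairs (pivot e) (D ∪ powExps e) i j).card +
        (goodPairs (pivot e) (D ∪ powExps e) (i + 1) j).card := by
  have hI := hasExponents_sup (k := k) hU e
  rw [hJ, hI.gradedBetti_add,
    hI.finrank_koszulCycles _ (apply_pivot_ne_zero e) _ _ (exchange_pivot_mem hD),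
    hI.finrank_koszulCycles _ (apply_pivot_ne_zero e) _ _ (exchange_pivot_mem hD)]

theorem hilbertSeries_eq_iff {J L : Ideal (MvPolynomial (Fin n) k)} (hJ : IsMonomialIdeal J)
    (hL : IsMonomialIdeal L) (e : Fin n → ℕ∞) :
    hilbertSeries (L ⊔ powersIdeal k e) = hilbertSeries (J ⊔ powersIdeal k e) ↔
      ∀ d, (boxPart e (exponents L) d).card = (boxPart e (exponents J) d).card := by
  have h : ∀ {I : Ideal (MvPolynomial (Fin n) k)}, IsMonomialIdeal I → ∀ d : ℕ,
      Module.finrank k (idealPart (I ⊔ powersIdeal k e) d) =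
        (degPart (powExps e) d).card + (boxPart e (exponents I) d).card := by
    intro I hI d
    have hE := hasExponents_sup (k := k) (isUpperSet_exponents I) e
    rw [← hI] at hE
    rw [hE.finrank_idealPart, card_degPart]
  simp only [PowerSeries.ext_iff, hilbertSeries, PowerSeries.coeff_mk, h hJ, h hL, Nat.cast_inj,
    Nat.add_left_cancel_iff]

/-- The existence of the lexicographic ideal. Its monomials of degree `d` are those larger than
every element of the box outside the lexicographic segment of the required size; that they form
an ideal is the Clements–Lindström inequality. -/
theorem exists_isLexSegment {J : Ideal (MvPolynomial (Fin n) k)} (hJ : IsStronglyStable J)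
    (e : Fin n → ℕ∞) (he : ∀ p, 0 < e p) :
    ∃ L : Ideal (MvPolynomial (Fin n) k), IsLexSegment L ∧
      hilbertSeries (L ⊔ powersIdeal k e) = hilbertSeries (J ⊔ powersIdeal k e) := by
  have hΛ := fun d =>
    exists_isLexSet_card (Finset.card_le_card (boxPart_subset_box e (exponents J) d))
  choose Λ hlex hcard using hΛ
  have hshadow : ∀ d, shadow e d (Λ d) ⊆ Λ (d + 1) := fun d => by
    refine (isLexSet_shadow (hlex d)).subset_of_card_le (hlex (d + 1)) ?_
    rw [hcard (d + 1)]
    refine (shadowBound e he d _ _ (boxPart_subset_box e (exponents J) d)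
      (HasExchange.isBorel hJ.2 e d) (hlex d) (hcard d).le).trans (Finset.card_le_card ?_)
    intro w hw
    obtain ⟨hwb, u, hu, p, rfl⟩ := mem_shadow.1 hw
    refine mem_boxPart.2 ⟨hwb, isUpperSet_exponents J (fun i => ?_) (mem_boxPart.1 hu).2⟩
    simp
  set D : Set (Fin n →₀ ℕ) := {c | ∀ w ∈ box e c.degree, w ∉ Λ c.degree → toLex w < toLex ⇑c}
    with hDdef
  have hstep : ∀ c ∈ D, ∀ p, c + Finsupp.single p 1 ∈ D := by
    intro c hc p w hw hwΛ
    have hdeg : (c + Finsupp.single p 1).degree = c.degree + 1 := by simp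
    rw [hdeg] at hw hwΛ
    have hws := (mem_box.1 hw).1
    obtain ⟨q, hq, hlast⟩ := exists_last_ne_zero (w := w) (by omega)
    have hsum := sum_sub_single hq
    have hb : w - Pi.single q 1 ∈ box e c.degree :=
      mem_box_of_le hw (fun i => by simp) (by omega)
    have hlt := hc _ hb fun hmem => hwΛ (hshadow _ (mem_shadow.2
      ⟨hw, _, hmem, q, (sub_add_single hq).symm⟩))
    refine (((IsPrefix.refl w).sub_single hlast).toLex_lt ?_ hlt).trans_le ?_
    · rw [(mem_box.1 hb).1, Finsupp.degree_eq_sum]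
    · rw [Finsupp.coe_add, Finsupp.single_eq_pi_single]
      exact toLex_le_add_single _ _
  have hU : IsUpperSet D := by
    intro a b hab ha
    obtain ⟨c, rfl⟩ := exists_add_of_le hab
    clear hab
    induction c using Finsupp.induction_linear generalizing a with
    | zero => simpa using ha
    | add f g hf hg => rw [← add_assoc]; exact hg (hf ha)
    | single p t =>
      induction t with
      | zero => simpa using ha
      | succ t ih => rw [Finsupp.single_add, ← add_assoc]; exact hstep _ ih p
  have hexp := exponents_monomialIdeal (k := k) hU
  have hmon : IsMonomialIdeal (monomialIdeal k D) := by rw [IsMonomialIdeal, hexp]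
  refine ⟨monomialIdeal k D, ⟨hmon, ?_⟩, ?_⟩
  · rw [hexp]
    intro u v hdeg hlt hv w hw hwΛ
    rw [hdeg] at hw hwΛ
    exact (hv w hw hwΛ).trans hlt
  · rw [hilbertSeries_eq_iff hJ.1 hmon, hexp]
    intro d
    rw [← hcard d]
    congr 1
    ext u
    rw [mem_boxPart]
    constructor
    · rintro ⟨hb, hu⟩
      by_contra hcon
      have := hu u
      rw [degree_equivFunOnFinite_symm, (mem_box.1 hb).1] at this
      exact lt_irrefl _ (this hb hcon)
    · intro hu
      have hb := (hlex d).1 hu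
      refine ⟨hb, fun w hw hwΛ => ?_⟩
      rw [degree_equivFunOnFinite_symm, (mem_box.1 hb).1] at hw hwΛ
      rw [Finsupp.coe_equivFunOnFinite_symm]
      by_contra hcon
      exact hwΛ ((hlex d).mem_of_not_lt hu hw hcon)

end Ideals

theorem mainTheorem4 {n : ℕ} {k : Type*} [Field k]
    (e : Fin (n + 1) → ℕ∞) (he : ∀ p, 2 ≤ e p) (hmono : Monotone e)
    (J : Ideal (MvPolynomial (Fin (n + 1)) k)) (hJ : IsStronglyStable J) :
    (∀ (K : Type*) [Field K] (i : ℕ) (j : ℤ),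
      gradedBetti (monomialIdeal K (exponents J) ⊔ powersIdeal K e) i j =
        gradedBetti (J ⊔ powersIdeal k e) i j) ∧
    (∃ L : Ideal (MvPolynomial (Fin (n + 1)) k), IsLexSegment L ∧
      hilbertSeries (L ⊔ powersIdeal k e) = hilbertSeries (J ⊔ powersIdeal k e)) ∧
    (∀ L : Ideal (MvPolynomial (Fin (n + 1)) k), IsLexSegment L →
      hilbertSeries (L ⊔ powersIdeal k e) = hilbertSeries (J ⊔ powersIdeal k e) →
      ∀ (i : ℕ) (j : ℤ),
        gradedBetti (J ⊔ powersIdeal k e) i j ≤ gradedBetti (L ⊔ powersIdeal k e) i j) := by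
  have hUJ := isUpperSet_exponents J
  have hbJ := gradedBetti_add_card_pairs hJ.1 hUJ hJ.2 e
  refine ⟨fun K _ i j => ?_, ?_, fun L hL hH i j => ?_⟩
  · have h1 := gradedBetti_add_card_pairs (k := K) rfl hUJ hJ.2 e i j
    have h2 := hbJ i j
    omega
  · exact exists_isLexSegment hJ e fun p => lt_of_lt_of_le (by norm_num) (he p)
  · have hc := (hilbertSeries_eq_iff hJ.1 hL.1 e).1 hH
    have h1 := hbJ i j
    have h2 := gradedBetti_add_card_pairs hL.1 (isUpperSet_exponents L) hL.hasExchange e i j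
    have hle := card_goodPairs_le he (HasExchange.isBorel hJ.2 e) (hL.isLexSet e)
      (fun d => (hc d).symm)
    have h3 := hle i j
    have h4 := hle (i + 1) j
    have hpairs : (pairs (exponents J ∪ powExps e) (i + 1) j).card =
        (pairs (exponents L ∪ powExps e) (i + 1) j).card := by
      rw [card_pairs, card_pairs]
      congr 1
      cases j - (i + 1 : ℕ) with
      | ofNat d =>
        exact (card_degPart e (exponents J) d).trans
          ((congrArg _ (hc d).symm).trans (card_degPart e (exponents L) d).symm)
      | negSucc d => rfl
    omega
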